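/- Let $F:\mathbb{R}^m\times\mathbb{R}^s\to\mathbb{R}^s$ be continuously differentiable and let $\tilde q:\mathbb{R}^s\to\mathbb{R}\cup\{+\infty\}$ be a proper, convex, lower semicontinuous function that is piecewise linear-quadratic, i.e. $\operatorname{dom}\tilde q$ is the union of finitely many polyhedral sets, relative to each of which $\tilde q(x)$ is given in the form $\frac12\langle x,Ax\rangle+\langle a,x\rangle+\alpha$ with a symmetric matrix $A$, a vector $a$ and a scalar $\alpha$. Write $\partial$ for the subdifferential of convex analysis, let $$S(p)=\{x\in\mathbb{R}^s \mid 0\in F(p,x)+\partial\tilde q(x)\},\qquad p\in\mathbb{R}^m,$$ and let $\bar x\in S(\bar p)$. Put $\bar v=-F(\bar p,\bar x)$ and $\varphi(k)=\frac12 d^2\tilde q(\bar x\,|\,\bar v)(k)$, where $$d^2\tilde q(\bar x\,|\,\bar v)(k)=\liminf_{\tau\searrow 0,\ k'\to k}\frac{\tilde q(\bar x+\tau k')-\tilde q(\bar x)-\tau\langle\bar v,k'\rangle}{\frac12\tau^2}$$ is the second-order subderivative of $\tilde q$ at $\bar x$ for $\bar v$. Assume that the multifunction $$\Xi(w)=\{k\in\mathbb{R}^s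 \mid w\in\nabla_xF(\bar p,\bar x)k+\partial\varphi(k)\}$$ is single-valued on $\mathbb{R}^s$, i.e. $\Xi(w)$ consists of exactly one element for every $w\in\mathbb{R}^s$. Then $S$ has a single-valued and Lipschitzian localization around $(\bar p,\bar x)$: there are neighborhoods $\mathcal U$ of $\bar p$ and $\mathcal V$ of $\bar x$ and a Lipschitz continuous mapping $\sigma:\mathcal U\to\mathbb{R}^s$ such that $\sigma(\bar p)=\bar x$ and $S(p)\cap\mathcal V=\{\sigma(p)\}$ for all $p\in\mathcal U$. -/

import Mathlib

open Filter Topology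
open scoped RealInnerProductSpace

noncomputable section

namespace VarIneq

section General

variable {E : Type*} [NormedAddCommGroup E] [InnerProductSpace ℝ E]

/-- The effective domain of an extended-real-valued function. -/
def effDomain (q : E → EReal) : Set E := {x | q x < ⊤}

/-- Properness: the value `-∞` is never taken and the effective domain is nonempty. -/
def IsProper (q : E → EReal) : Prop := (∀ x, q x ≠ ⊥) ∧ (effDomain q).Nonempty

/-- Convexity of an extended-real-valued function: its epigraph is a convex set. -/
def IsConvexFun (q : E → EReal) : Prop := Convex ℝ {z : E × ℝ | q z.1 ≤ (z.2 : EReal)}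

/-- A polyhedral set: the solution set of finitely many affine inequalities. -/
def IsPolyhedral (C : Set E) : Prop :=
  ∃ (N : ℕ) (a : Fin N → E) (b : Fin N → ℝ), C = {x | ∀ i, ⟪a i, x⟫ ≤ b i}

/-- Piecewise linear-quadratic functions: the effective domain is a union of finitely many
polyhedral sets, relative to each of which `q` is given by an expression
`(1/2)⟨x, A x⟩ + ⟨a, x⟩ + α` with `A` symmetric. -/
def IsPiecewiseLinearQuadratic (q : E → EReal) : Prop :=
  ∃ (N : ℕ) (C : Fin N → Set E),
    (∀ i, IsPolyhedral (C i)) ∧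
    effDomain q = ⋃ i, C i ∧
    ∀ i, ∃ (A : E →ₗ[ℝ] E) (a : E) (α : ℝ), A.IsSymmetric ∧
      ∀ x ∈ C i, q x = (((1 / 2 : ℝ) * ⟪x, A x⟫ + ⟪a, x⟫ + α : ℝ) : EReal)

/-- The subdifferential of convex analysis, empty at points where `q` is not finite. -/
def subdifferential (q : E → EReal) (x : E) : Set E :=
  {v | q x ≠ ⊥ ∧ q x ≠ ⊤ ∧ ∀ y, q x + ((⟪v, y - x⟫ : ℝ) : EReal) ≤ q y}

/-- The second-order difference quotient
`(q (x + τ w) - q x - τ ⟨v, w⟩) / (τ² / 2)` (used for `τ > 0` and `q x` finite). -/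
def secondDiffQuotient (q : E → EReal) (x v : E) (τ : ℝ) (w : E) : EReal :=
  ((((1 / 2 : ℝ) * τ ^ 2)⁻¹ : ℝ) : EReal) *
    (q (x + τ • w) - q x - ((τ * ⟪v, w⟫ : ℝ) : EReal))

/-- The second-order subderivative `d²q(x | v)(w)`: the lower limit of the second-order
difference quotients as `τ ↘ 0` and `w' → w`. -/
def secondSubderivative (q : E → EReal) (x v w : E) : EReal :=
  liminf (fun z : ℝ × E => secondDiffQuotient q x v z.1 z.2) (𝓝[>] (0 : ℝ) ×ˢ 𝓝 w)

/-- The function `½ d²q(x | v)`. -/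
def halfSecondSubderivative (q : E → EReal) (x v : E) : E → EReal :=
  fun w => ((1 / 2 : ℝ) : EReal) * secondSubderivative q x v w

end General

section Multifunctions

/-- A multifunction `S` has a single-valued and Lipschitzian localization around `(u₀, v₀)`. -/
def HasSingleValuedLipschitzLocalization {X Y : Type*} [PseudoEMetricSpace X]
    [PseudoEMetricSpace Y] (S : X → Set Y) (u₀ : X) (v₀ : Y) : Prop :=
  ∃ U ∈ 𝓝 u₀, ∃ V ∈ 𝓝 v₀, ∃ σ : X → Y,
    (∃ K : NNReal, LipschitzOnWith K σ U) ∧ σ u₀ = v₀ ∧ ∀ u ∈ U, S u ∩ V = {σ u}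

variable {P E : Type*} [NormedAddCommGroup P] [NormedSpace ℝ P]
  [NormedAddCommGroup E] [InnerProductSpace ℝ E]

/-- The solution mapping `S(p) = {x | 0 ∈ F(p, x) + ∂q(x)}` of the generalized equation. -/
def solutionMap (F : P × E → E) (q : E → EReal) (p : P) : Set E :=
  {x | ∃ v ∈ subdifferential q x, 0 = F (p, x) + v}

/-- The partial derivative `∇ₓF(p, x)`. -/
def partialDerivX (F : P × E → E) (p : P) (x : E) : E →L[ℝ] E :=
  fderiv ℝ (fun y => F (p, y)) x

/-- The multifunction `Ξ(w) = {k | w ∈ ∇ₓF(p, x) k + ∂φ(k)}` with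
`φ = ½ d²q(x | -F(p, x))`. -/
def XiMap (F : P × E → E) (q : E → EReal) (p : P) (x : E) (w : E) : Set E :=
  {k | ∃ v ∈ subdifferential (halfSecondSubderivative q x (-F (p, x))) k,
    w = partialDerivX F p x k + v}

end Multifunctions

end VarIneq

end

/-! Write `x = x₀ + k`, `M = ∇ₓF(p₀, x₀)`, `v = -F(p₀, x₀)`. The proof replaces `q` near `(x₀, v)`
by its second-order model and solves the resulting equation as a fixed-point problem.

Near `x₀`, `k ↦ q(x₀ + k) - q(x₀) - ⟪v, k⟫` is nonnegative, convex and of the form `½⟪k, A i k⟫ + ⟪b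
i, k⟫` on finitely many polyhedral cones `K i`, with `b i ≥ 0` on `K i`. The function `φ = ½ d²q(x₀
| v)` is `½⟪k, A i k⟫` on the faces `K i ∩ (b i)^⊥` and `+∞` elsewhere. For `(k, u)` near the
origin, `v + u ∈ ∂q(x₀ + k)` if and only if `u ∈ ∂φ(k)`: off the faces the linear term dominates, by
a Hoffman-type error bound (`exists_error_bound`), every small second-order or linear perturbation
(`exists_mem_subgradients_iff`).

The graph of `∂φ` splits into finitely many convex cones, indexed by the signs of the constraints at
the base point (`combo_mem_subgradients`). A single-valued inverse `ξ` of `M + ∂φ` is therefore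
additive and positively homogeneous on finitely many cones whose closures cover the space, hence
globally Lipschitz (`IsConicPLQ.exists_lipschitzWith_inverse`).

Locally, `x₀ + k ∈ S(p)` now means `k = ξ(M k - F(p, x₀ + k) + F(p₀, x₀))`. Strict differentiability
makes the argument of `ξ` Lipschitz in `k` with arbitrarily small constant and Lipschitz in `p`, so
the parametric contraction principle applies. -/

namespace VarIneq

/-! ### Polyhedral cones: finite generation and an error bound for faces. -/

section PolyhedralCones

variable {E : Type*} [NormedAddCommGroup E] [InnerProductSpace ℝ E]

/-- The polyhedral cone cut out by finitely many homogeneous linear inequalities. -/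
def polyCone (T : Finset E) : Set E := {k | ∀ a ∈ T, ⟪a, k⟫ ≤ 0}

lemma mem_polyCone {T : Finset E} {k : E} : k ∈ polyCone T ↔ ∀ a ∈ T, ⟪a, k⟫ ≤ 0 := Iff.rfl

lemma mem_polyCone_insert [DecidableEq E] {T : Finset E} {b k : E} :
    k ∈ polyCone (insert b T) ↔ ⟪b, k⟫ ≤ 0 ∧ k ∈ polyCone T := by
  simp [mem_polyCone]

lemma isClosed_polyCone (T : Finset E) : IsClosed (polyCone T) := by
  have : polyCone T = ⋂ a ∈ T, {k : E | ⟪a, k⟫ ≤ 0} := by ext; simp [mem_polyCone]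
  rw [this]
  exact isClosed_biInter fun a _ => isClosed_le (by fun_prop) continuous_const

lemma polyCone_combo {T : Finset E} {k l : E} (hk : k ∈ polyCone T) (hl : l ∈ polyCone T)
    {α β : ℝ} (hα : 0 ≤ α) (hβ : 0 ≤ β) : α • k + β • l ∈ polyCone T := by
  intro a ha
  rw [inner_add_right, inner_smul_right, inner_smul_right]
  have h1 := mul_nonneg hα (neg_nonneg.2 (hk a ha))
  have h2 := mul_nonneg hβ (neg_nonneg.2 (hl a ha))
  linarith

lemma smul_mem_polyCone {T : Finset E} {k : E} (hk : k ∈ polyCone T) {t : ℝ} (ht : 0 ≤ t) :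
    t • k ∈ polyCone T := by
  simpa using polyCone_combo hk hk ht le_rfl

lemma smul_mem_polyCone_iff {T : Finset E} {k : E} {t : ℝ} (ht : 0 < t) :
    t • k ∈ polyCone T ↔ k ∈ polyCone T := by
  refine ⟨fun h => ?_, fun h => smul_mem_polyCone h ht.le⟩
  have := smul_mem_polyCone h (inv_nonneg.2 ht.le)
  rwa [smul_smul, inv_mul_cancel₀ ht.ne', one_smul] at this

lemma hull_smul_mem {s : Set E} {x : E} (hx : x ∈ PointedCone.hull ℝ s) {c : ℝ} (hc : 0 ≤ c) :
    c • x ∈ PointedCone.hull ℝ s :=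
  (PointedCone.hull ℝ s).smul_mem hc hx

lemma hull_union (s t : Set E) :
    PointedCone.hull ℝ (s ∪ t) = PointedCone.hull ℝ s ⊔ PointedCone.hull ℝ t :=
  Submodule.span_union s t

/-- The intersection of a finitely generated cone with a half-space is finitely generated. -/
lemma exists_hull_inter_halfspace (R : Finset E) (a : E) :
    ∃ R' : Finset E, ∀ y, y ∈ PointedCone.hull ℝ (R' : Set E) ↔
      y ∈ PointedCone.hull ℝ (R : Set E) ∧ ⟪a, y⟫ ≤ 0 := by
  classical
  set Rn := R.filter fun r => ⟪a, r⟫ ≤ 0 with hRn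
  set Rp := R.filter fun r => 0 < ⟪a, r⟫ with hRp
  -- Double description step: keep the generators in the half-space and add, for each pair on
  -- opposite sides, the nonnegative combination lying on the hyperplane `a^⊥`.
  set R' := Rn ∪ (Rp ×ˢ Rn).image fun z => ⟪a, z.1⟫ • z.2 - ⟪a, z.2⟫ • z.1 with hR'
  have hn_sub : PointedCone.hull ℝ (Rn : Set E) ≤ PointedCone.hull ℝ (R' : Set E) :=
    Submodule.span_mono (by simp [hR'])
  have hn_neg : ∀ n ∈ PointedCone.hull ℝ (Rn : Set E), ⟪a, n⟫ ≤ 0 := by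
    intro n hn
    induction hn using Submodule.span_induction with
    | mem x hx => exact (Finset.mem_filter.1 hx).2
    | zero => simp
    | add x y _ _ hx hy => rw [inner_add_right]; linarith
    | smul c x _ hx =>
      change ⟪a, (c : ℝ) • x⟫ ≤ 0
      rw [inner_smul_right]
      exact mul_nonpos_of_nonneg_of_nonpos c.2 hx
  have hp_pos : ∀ p ∈ PointedCone.hull ℝ (Rp : Set E), p = 0 ∨ 0 < ⟪a, p⟫ := by
    intro n hn
    induction hn using Submodule.span_induction with
    | mem x hx => exact Or.inr (Finset.mem_filter.1 hx).2
    | zero => simp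
    | add x y _ _ hx hy =>
      rcases hx with rfl | hx
      · simpa using hy
      rcases hy with rfl | hy
      · right; simpa using hx
      · right; rw [inner_add_right]; linarith
    | smul c x _ hx =>
      change (c : ℝ) • x = 0 ∨ 0 < ⟪a, (c : ℝ) • x⟫
      rcases hx with rfl | hx
      · simp
      rcases c.2.eq_or_lt with h | h
      · left; rw [← h]; simp
      · right; rw [inner_smul_right]; exact mul_pos h hx
  have hmix : ∀ p ∈ PointedCone.hull ℝ (Rp : Set E), ∀ n ∈ PointedCone.hull ℝ (Rn : Set E),
      ⟪a, p⟫ • n - ⟪a, n⟫ • p ∈ PointedCone.hull ℝ (R' : Set E) := by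
    intro p hp n hn
    induction hp using Submodule.span_induction with
    | mem p hp =>
      induction hn using Submodule.span_induction with
      | mem n hn =>
        apply Submodule.subset_span
        simp only [hR', Finset.coe_union, Finset.coe_image, Set.mem_union, Set.mem_image]
        right
        exact ⟨(p, n), by simpa using ⟨hp, hn⟩, rfl⟩
      | zero => simp
      | add x y _ _ hx hy =>
        convert add_mem hx hy using 1
        rw [inner_add_right]; module
      | smul c x _ hx =>
        change ⟪a, p⟫ • ((c : ℝ) • x) - ⟪a, (c : ℝ) • x⟫ • p ∈ _
        convert hull_smul_mem hx c.2 using 1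
        rw [inner_smul_right]; module
    | zero => simp
    | add x y _ _ hx hy =>
      convert add_mem hx hy using 1
      rw [inner_add_right]; module
    | smul c x _ hx =>
      change ⟪a, (c : ℝ) • x⟫ • n - ⟪a, n⟫ • ((c : ℝ) • x) ∈ _
      convert hull_smul_mem hx c.2 using 1
      rw [inner_smul_right]; module
  have hsplit : PointedCone.hull ℝ (R : Set E) =
      PointedCone.hull ℝ (Rp : Set E) ⊔ PointedCone.hull ℝ (Rn : Set E) := by
    have : R = Rp ∪ Rn := by
      ext r
      simp only [hRp, hRn, Finset.mem_union, Finset.mem_filter, ← and_or_left]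
      simp [lt_or_ge]
    rw [this, Finset.coe_union, hull_union]
  refine ⟨R', fun y => ⟨fun hy => ?_, fun ⟨hy, hay⟩ => ?_⟩⟩
  · induction hy using Submodule.span_induction with
    | mem x hx =>
      simp only [hR', Finset.coe_union, Finset.coe_image, Set.mem_union, Set.mem_image] at hx
      rcases hx with hx | ⟨⟨p, n⟩, hpn, rfl⟩
      · exact ⟨Submodule.subset_span (Finset.mem_filter.1 hx).1, (Finset.mem_filter.1 hx).2⟩
      · obtain ⟨hp, hn⟩ : p ∈ Rp ∧ n ∈ Rn := by simpa using hpn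
        obtain ⟨hpR, hp⟩ := Finset.mem_filter.1 hp
        obtain ⟨hnR, hn⟩ := Finset.mem_filter.1 hn
        constructor
        · have h1 := hull_smul_mem (Submodule.subset_span hnR : n ∈ PointedCone.hull ℝ (R : Set E))
            hp.le
          have h2 := hull_smul_mem (Submodule.subset_span hpR : p ∈ PointedCone.hull ℝ (R : Set E))
            (neg_nonneg.2 hn)
          convert add_mem h1 h2 using 1
          module
        · simp only [inner_sub_right, inner_smul_right]
          linarith [mul_comm ⟪a, p⟫ ⟪a, n⟫]
    | zero => simp
    | add x y _ _ hx hy =>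
      exact ⟨add_mem hx.1 hy.1, by rw [inner_add_right]; linarith [hx.2, hy.2]⟩
    | smul c x _ hx =>
      refine ⟨Submodule.smul_mem _ _ hx.1, ?_⟩
      change ⟪a, (c : ℝ) • x⟫ ≤ 0
      rw [inner_smul_right]
      exact mul_nonpos_of_nonneg_of_nonpos c.2 hx.2
  · rw [hsplit] at hy
    obtain ⟨p, hp, n, hn, rfl⟩ := Submodule.mem_sup.1 hy
    rcases hp_pos p hp with rfl | hpos
    · simpa using hn_sub hn
    rw [inner_add_right] at hay
    have hneg : 0 < -⟪a, n⟫ := by linarith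
    -- With `s = -⟪a, n⟫ > 0`, `p + n = s⁻¹ (⟪a, p⟫ n + s p) + (1 - s⁻¹ ⟪a, p⟫) n`; the last
    -- coefficient is nonnegative because `⟪a, p + n⟫ ≤ 0`.
    have h1 := hull_smul_mem (hmix p hp n hn) (inv_nonneg.2 hneg.le)
    have h2 := hull_smul_mem (hn_sub hn) (c := 1 - (-⟪a, n⟫)⁻¹ * ⟪a, p⟫) (by
      rw [sub_nonneg, inv_mul_le_iff₀ hneg]; linarith)
    convert add_mem h1 h2 using 1
    have h3 : p = ((-⟪a, n⟫)⁻¹ * (-⟪a, n⟫)) • p := by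
      rw [inv_mul_cancel₀ hneg.ne', one_smul]
    nth_rewrite 1 [h3]
    module

variable [FiniteDimensional ℝ E]

/-- A polyhedral cone is finitely generated. -/
lemma exists_hull_eq_polyCone (T : Finset E) :
    ∃ R : Finset E, ∀ y, y ∈ PointedCone.hull ℝ (R : Set E) ↔ y ∈ polyCone T := by
  classical
  induction T using Finset.induction_on with
  | empty =>
    let e := Module.finBasis ℝ E
    refine ⟨Finset.univ.image e ∪ Finset.univ.image (fun i => -e i), fun y => ?_⟩
    simp only [mem_polyCone, Finset.notMem_empty, false_imp_iff, implies_true, iff_true]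
    rw [← e.sum_repr y]
    refine sum_mem fun i _ => ?_
    rcases le_total 0 (e.repr y i) with h | h
    · exact hull_smul_mem (Submodule.subset_span (by simp)) h
    · rw [← neg_smul_neg]
      exact hull_smul_mem (Submodule.subset_span (by simp)) (neg_nonneg.2 h)
  | insert a T _ ih =>
    obtain ⟨R, hR⟩ := ih
    obtain ⟨R', hR'⟩ := exists_hull_inter_halfspace R a
    refine ⟨R', fun y => ?_⟩
    rw [hR', hR, mem_polyCone_insert, and_comm]

/-- An error bound: if `b` is nonnegative on a polyhedral cone `K`, then the distance of `y ∈ K`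
to the face `K ∩ b^⊥` is bounded by a multiple of `⟪b, y⟫`. -/
lemma exists_error_bound (T : Finset E) (b : E) (hb : ∀ y ∈ polyCone T, 0 ≤ ⟪b, y⟫) :
    ∃ C : ℝ, 0 ≤ C ∧ ∀ y ∈ polyCone T, ∃ y' ∈ polyCone T, ⟪b, y'⟫ = 0 ∧
      ‖y - y'‖ ≤ C * ⟪b, y⟫ := by
  obtain ⟨R, hR⟩ := exists_hull_eq_polyCone T
  have hC : ∃ C : ℝ, 0 ≤ C ∧ ∀ r ∈ R, 0 < ⟪b, r⟫ → ‖r‖ ≤ C * ⟪b, r⟫ := by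
    refine ⟨∑ r ∈ R, ‖r‖ / |⟪b, r⟫|, by positivity, fun r hr hpos => ?_⟩
    have : ‖r‖ / |⟪b, r⟫| ≤ ∑ r ∈ R, ‖r‖ / |⟪b, r⟫| :=
      Finset.single_le_sum (f := fun r => ‖r‖ / |⟪b, r⟫|) (fun _ _ => by positivity) hr
    rwa [abs_of_pos hpos, div_le_iff₀ hpos] at this
  obtain ⟨C, hC0, hC⟩ := hC
  refine ⟨C, hC0, fun y hy => ?_⟩
  rw [← hR] at hy
  simp only [← hR] at hb ⊢
  -- The claim is stable under sums and nonnegative multiples, so only generators matter: those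
  -- orthogonal to `b` stay put, the others are moved to `0`.
  induction hy using Submodule.span_induction with
  | mem r hr =>
    have hr' : r ∈ PointedCone.hull ℝ (R : Set E) := Submodule.subset_span hr
    rcases (hb r hr').eq_or_lt with h | h
    · exact ⟨r, hr', h.symm, by simp [← h]⟩
    · exact ⟨0, zero_mem _, by simp, by simpa using hC r hr h⟩
  | zero => exact ⟨0, zero_mem _, by simp, by simp⟩
  | add x y _ _ hx hy =>
    obtain ⟨x', hx', hx0, hxC⟩ := hx
    obtain ⟨y', hy', hy0, hyC⟩ := hy
    refine ⟨x' + y', add_mem hx' hy', by rw [inner_add_right, hx0, hy0, add_zero], ?_⟩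
    rw [inner_add_right, add_sub_add_comm]
    linarith [norm_add_le (x - x') (y - y')]
  | smul c x _ hx =>
    obtain ⟨x', hx', hx0, hxC⟩ := hx
    refine ⟨(c : ℝ) • x', hull_smul_mem hx' c.2, by rw [inner_smul_right, hx0, mul_zero], ?_⟩
    change ‖(c : ℝ) • x - (c : ℝ) • x'‖ ≤ C * ⟪b, (c : ℝ) • x⟫
    rw [← smul_sub, norm_smul, inner_smul_right, Real.norm_of_nonneg c.2]
    linarith [mul_le_mul_of_nonneg_left hxC c.2]

end PolyhedralCones

/-- Pigeonhole principle along a filter; it selects one of finitely many pieces that is visited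
arbitrarily close to a limit point. -/
lemma exists_frequently_of_eventually_exists {X ι : Type*} [Finite ι] {l : Filter X} [l.NeBot]
    {p : ι → X → Prop} (h : ∀ᶠ x in l, ∃ i, p i x) : ∃ i, ∃ᶠ x in l, p i x := by
  by_contra! H
  have H' : ∀ᶠ x in l, ∀ i, ¬ p i x := eventually_all.2 H
  obtain ⟨x, ⟨i, hi⟩, hx⟩ := (h.and H').exists
  exact hx i hi

lemma le_of_forall_small {x y c t₀ : ℝ} (ht₀ : 0 < t₀)
    (h : ∀ t, 0 < t → t ≤ t₀ → x ≤ y + t * c) : x ≤ y := by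
  have h1 : Tendsto (fun t : ℝ => y + t * c) (𝓝[>] 0) (𝓝 y) := by
    have : Tendsto (fun t : ℝ => y + t * c) (𝓝 0) (𝓝 (y + 0 * c)) := by
      apply Continuous.tendsto; fun_prop
    simpa using this.mono_left nhdsWithin_le_nhds
  refine ge_of_tendsto h1 ?_
  filter_upwards [Ioc_mem_nhdsGT ht₀] with t ht using h t ht.1 ht.2

/-! ### Convex functions that are purely quadratic on polyhedral cones, and their subgradients. -/

section ConicPLQ

variable {E : Type*} [NormedAddCommGroup E] [InnerProductSpace ℝ E]

/-- The subgradients at `x` of the function that equals `f` on `D` and `+∞` elsewhere. -/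
def subgradients (D : Set E) (f : E → ℝ) (x : E) : Set E :=
  {v | x ∈ D ∧ ∀ y ∈ D, f x + ⟪v, y - x⟫ ≤ f y}

/-- Subgradients of a convex function are determined by local inequalities. -/
lemma mem_subgradients_of_local {D : Set E} {f : E → ℝ} (hf : ConvexOn ℝ D f) {x v : E} {ε : ℝ}
    (hε : 0 < ε) (hx : x ∈ D) (h : ∀ y ∈ D, ‖y - x‖ < ε → f x + ⟪v, y - x⟫ ≤ f y) :
    v ∈ subgradients D f x := by
  refine ⟨hx, fun y hy => ?_⟩
  set t : ℝ := min 1 (ε / (2 * (‖y - x‖ + 1))) with ht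
  have hy0 : 0 ≤ ‖y - x‖ := norm_nonneg _
  have ht0 : 0 < t := by rw [ht]; positivity
  have ht1 : t ≤ 1 := min_le_left _ _
  have ht2 : t * (2 * (‖y - x‖ + 1)) ≤ ε := by
    rw [← le_div_iff₀ (by positivity)]; exact min_le_right _ _
  have hmem := hf.1 hx hy (sub_nonneg.2 ht1) ht0.le (by ring)
  have hle := hf.2 hx hy (sub_nonneg.2 ht1) ht0.le (by ring)
  have heq : (1 - t) • x + t • y - x = t • (y - x) := by module
  have := h _ hmem (by
    rw [heq, norm_smul, Real.norm_of_nonneg ht0.le]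
    nlinarith)
  rw [heq, inner_smul_right] at this
  simp only [smul_eq_mul] at hle
  have : t * (f x + ⟪v, y - x⟫) ≤ t * f y := by linarith
  exact le_of_mul_le_mul_left this ht0

/-- A convex function that is purely quadratic on each of the polyhedral cones whose union is
its domain. -/
structure IsConicPLQ {ι : Type*} (T : ι → Finset E) (A : ι → E →L[ℝ] E) (D : Set E)
    (f : E → ℝ) : Prop where
  dom : D = ⋃ i, polyCone (T i)
  eq : ∀ i, ∀ k ∈ polyCone (T i), f k = 1 / 2 * ⟪k, A i k⟫
  symm : ∀ i x y, ⟪A i x, y⟫ = ⟪x, A i y⟫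
  convex : ConvexOn ℝ D f

lemma quadratic_expand {A : E →L[ℝ] E} (hA : ∀ x y, ⟪A x, y⟫ = ⟪x, A y⟫) (k h : E) (t : ℝ) :
    1 / 2 * ⟪k + t • h, A (k + t • h)⟫ =
      1 / 2 * ⟪k, A k⟫ + t * (⟪A k, h⟫ + t * (1 / 2 * ⟪h, A h⟫)) := by
  have : ⟪h, A k⟫ = ⟪A k, h⟫ := real_inner_comm _ _
  simp only [map_add, map_smul, inner_add_left, inner_add_right, inner_smul_left,
    inner_smul_right, RCLike.conj_to_real, ← hA k h, this]
  ring

namespace IsConicPLQ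

variable {ι : Type*} {T : ι → Finset E} {A : ι → E →L[ℝ] E} {D : Set E} {f : E → ℝ}

lemma mem_iff (H : IsConicPLQ T A D f) {k : E} : k ∈ D ↔ ∃ i, k ∈ polyCone (T i) := by
  rw [H.dom, Set.mem_iUnion]

lemma polyCone_segment {S : Finset E} {k h : E} {t₀ t : ℝ} (hk : k ∈ polyCone S)
    (hkh : k + t₀ • h ∈ polyCone S) (ht : 0 ≤ t) (htt : t ≤ t₀) (ht₀ : 0 < t₀) :
    k + t • h ∈ polyCone S := by
  have h1 : t / t₀ ≤ 1 := (div_le_one ht₀).2 htt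
  convert polyCone_combo hk hkh (sub_nonneg.2 h1) (div_nonneg ht ht₀.le) using 1
  have : t = t / t₀ * t₀ := by field_simp
  nth_rewrite 1 [this]
  module

/-- Inside one piece the directional derivative of `f` at `k` is `⟪A i k, h⟫`, and a subgradient
lies below it. The next lemma is the converse, by convexity along the segment to `y`. -/
lemma inner_le_of_mem_subgradients (H : IsConicPLQ T A D f) {k u h : E}
    (hu : u ∈ subgradients D f k) {i : ι} (hk : k ∈ polyCone (T i)) {t₀ : ℝ} (ht₀ : 0 < t₀)
    (hkh : k + t₀ • h ∈ polyCone (T i)) : ⟪u, h⟫ ≤ ⟪A i k, h⟫ := by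
  refine le_of_forall_small ht₀ (c := 1 / 2 * ⟪h, A i h⟫) fun t ht htt => ?_
  have hmem := polyCone_segment hk hkh ht.le htt ht₀
  have := hu.2 _ (H.mem_iff.2 ⟨i, hmem⟩)
  rw [H.eq i _ hk, H.eq i _ hmem, quadratic_expand (H.symm i), add_sub_cancel_left,
    inner_smul_right] at this
  exact le_of_mul_le_mul_left (by linarith) ht

lemma add_inner_le_of_inner_le (H : IsConicPLQ T A D f) {k u y : E} (hy : y ∈ D) {i : ι}
    (hk : k ∈ polyCone (T i)) {t₀ : ℝ} (ht₀ : 0 < t₀) (ht₁ : t₀ ≤ 1)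
    (hkh : k + t₀ • (y - k) ∈ polyCone (T i)) (hu : ⟪u, y - k⟫ ≤ ⟪A i k, y - k⟫) :
    f k + ⟪u, y - k⟫ ≤ f y := by
  suffices ⟪A i k, y - k⟫ ≤ f y - f k by linarith
  refine le_of_forall_small ht₀ (c := -(1 / 2 * ⟪y - k, A i (y - k)⟫)) fun t ht htt => ?_
  have hmem := polyCone_segment hk hkh ht.le htt ht₀
  have hle := H.convex.2 (H.mem_iff.2 ⟨i, hk⟩) hy (sub_nonneg.2 (htt.trans ht₁)) ht.le (by ring)
  have heq : (1 - t) • k + t • y = k + t • (y - k) := by module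
  rw [heq, H.eq i _ hmem, quadratic_expand (H.symm i), H.eq i _ hk, smul_eq_mul,
    smul_eq_mul] at hle
  rw [H.eq i _ hk]
  refine le_of_mul_le_mul_left ?_ ht
  linarith

/-- Some piece meets the segment from `k` to `y` arbitrarily close to `k`; being closed, it contains
`k`. -/
lemma exists_piece [Finite ι] (H : IsConicPLQ T A D f) {k y : E} (hk : k ∈ D) (hy : y ∈ D) :
    ∃ i, k ∈ polyCone (T i) ∧ ∃ t₀ : ℝ, 0 < t₀ ∧ t₀ ≤ 1 ∧
      k + t₀ • (y - k) ∈ polyCone (T i) := by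
  have hev : ∀ᶠ t : ℝ in 𝓝[>] 0, t ∈ Set.Ioc (0 : ℝ) 1 := Ioc_mem_nhdsGT one_pos
  have : ∀ᶠ t : ℝ in 𝓝[>] 0, ∃ i, k + t • (y - k) ∈ polyCone (T i) := by
    filter_upwards [hev] with t ht
    rw [← H.mem_iff]
    convert H.convex.1 hk hy (sub_nonneg.2 ht.2) ht.1.le (by ring) using 1
    module
  obtain ⟨i, hi⟩ := exists_frequently_of_eventually_exists this
  refine ⟨i, ?_, ?_⟩
  · have hlim : Tendsto (fun t : ℝ => k + t • (y - k)) (𝓝[>] 0) (𝓝 k) := by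
      have : Tendsto (fun t : ℝ => k + t • (y - k)) (𝓝 0) (𝓝 (k + (0 : ℝ) • (y - k))) := by
        apply Continuous.tendsto; fun_prop
      simpa using this.mono_left nhdsWithin_le_nhds
    exact (isClosed_polyCone _).mem_of_frequently_of_tendsto hi hlim
  · obtain ⟨t, h1, h2⟩ := (hi.and_eventually hev).exists
    exact ⟨t, h2.1, h2.2, h1⟩

/-- Feasibility of a direction depends only on which constraints are active at the base point:
inactive ones survive a short step. -/
lemma exists_pos_add_smul_mem {S : Finset E} {k k' h : E} (hk : k ∈ polyCone S)
    (hs : ∀ a ∈ S, SignType.sign ⟪a, k⟫ = SignType.sign ⟪a, k'⟫) {t₀ : ℝ} (ht₀ : 0 < t₀)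
    (hkh : k + t₀ • h ∈ polyCone S) :
    k' ∈ polyCone S ∧ ∃ t₁ : ℝ, 0 < t₁ ∧ k' + t₁ • h ∈ polyCone S := by
  have hcase : ∀ a ∈ S, (⟪a, k'⟫ = 0 ∧ ⟪a, h⟫ ≤ 0) ∨ ⟪a, k'⟫ < 0 := by
    intro a ha
    rcases (hk a ha).eq_or_lt with h0 | h0
    · left
      have h1 := hs a ha
      rw [h0, sign_zero, eq_comm, sign_eq_zero_iff] at h1
      have h2 := hkh a ha
      rw [inner_add_right, inner_smul_right, h0, zero_add] at h2
      exact ⟨h1, nonpos_of_mul_nonpos_right h2 ht₀⟩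
    · right
      have h1 := hs a ha
      rwa [sign_neg h0, eq_comm, sign_eq_neg_one_iff] at h1
  refine ⟨fun a ha => (hcase a ha).elim (fun h => h.1.le) le_of_lt, ?_⟩
  have : ∀ᶠ t : ℝ in 𝓝[>] 0, ∀ a ∈ S, ⟪a, k' + t • h⟫ ≤ 0 := by
    rw [Filter.eventually_all_finset]
    intro a ha
    rcases hcase a ha with ⟨h1, h2⟩ | h1
    · filter_upwards [self_mem_nhdsWithin] with t ht
      rw [inner_add_right, inner_smul_right, h1, zero_add]
      exact mul_nonpos_of_nonneg_of_nonpos (le_of_lt ht) h2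
    · have hlim : Tendsto (fun t : ℝ => ⟪a, k' + t • h⟫) (𝓝 0) (𝓝 ⟪a, k' + (0 : ℝ) • h⟫) := by
        apply Continuous.tendsto; fun_prop
      rw [zero_smul, add_zero] at hlim
      exact ((hlim.mono_left nhdsWithin_le_nhds).eventually_lt_const h1).mono fun _ => le_of_lt
  obtain ⟨t, ht, ht0⟩ := (this.and self_mem_nhdsWithin).exists
  exact ⟨t, ht0, ht⟩

lemma sign_combo {x y α β : ℝ} (h : SignType.sign x = SignType.sign y) (hα : 0 < α)
    (hβ : 0 < β) : SignType.sign (α * x + β * y) = SignType.sign x := by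
  rcases lt_trichotomy x 0 with hx | rfl | hx
  · rw [sign_neg hx, eq_comm, sign_eq_neg_one_iff] at h
    rw [sign_neg hx, sign_eq_neg_one_iff]
    nlinarith
  · rw [sign_zero, eq_comm, sign_eq_zero_iff] at h
    simp [h]
  · rw [sign_pos hx, eq_comm, sign_eq_one_iff] at h
    rw [sign_pos hx, sign_eq_one_iff]
    positivity

/-- Subgradient pairs whose base points satisfy the same constraints with equality, respectively
with strict inequality, form a convex cone. -/
lemma combo_mem_subgradients [Finite ι] (H : IsConicPLQ T A D f) {k₁ k₂ u₁ u₂ : E}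
    (hs : ∀ i, ∀ a ∈ T i, SignType.sign ⟪a, k₁⟫ = SignType.sign ⟪a, k₂⟫)
    (h₁ : u₁ ∈ subgradients D f k₁) (h₂ : u₂ ∈ subgradients D f k₂) {α β : ℝ} (hα : 0 < α)
    (hβ : 0 < β) : α • u₁ + β • u₂ ∈ subgradients D f (α • k₁ + β • k₂) := by
  have hs₁ : ∀ i, ∀ a ∈ T i, SignType.sign ⟪a, α • k₁ + β • k₂⟫ = SignType.sign ⟪a, k₁⟫ := by
    intro i a ha
    rw [inner_add_right, inner_smul_right, inner_smul_right]
    exact sign_combo (hs i a ha) hα hβ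
  have hk : α • k₁ + β • k₂ ∈ D := by
    obtain ⟨i, hi⟩ := H.mem_iff.1 h₁.1
    refine H.mem_iff.2 ⟨i, (exists_pos_add_smul_mem hi (fun a ha => (hs₁ i a ha).symm)
      (h := 0) one_pos (by simpa using hi)).1⟩
  refine ⟨hk, fun y hy => ?_⟩
  -- The piece entered from the combined point towards `y` is also entered in direction `y - k` from
  -- `k₁` and `k₂`, which have the same signs. The two gradient inequalities then involve the same
  -- `A i` and add up.
  obtain ⟨i, hki, t₀, ht₀, ht₁, hkh⟩ := H.exists_piece hk hy
  refine H.add_inner_le_of_inner_le hy hki ht₀ ht₁ hkh ?_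
  obtain ⟨hk₁, t₁, ht₁, hkh₁⟩ := exists_pos_add_smul_mem hki (hs₁ i) ht₀ hkh
  obtain ⟨hk₂, t₂, ht₂, hkh₂⟩ := exists_pos_add_smul_mem hki
    (fun a ha => (hs₁ i a ha).trans (hs i a ha)) ht₀ hkh
  have e₁ := mul_le_mul_of_nonneg_left (H.inner_le_of_mem_subgradients h₁ hk₁ ht₁ hkh₁) hα.le
  have e₂ := mul_le_mul_of_nonneg_left (H.inner_le_of_mem_subgradients h₂ hk₂ ht₂ hkh₂) hβ.le
  rw [map_add, map_smul, map_smul, inner_add_left, inner_add_left]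
  simp only [real_inner_smul_left]
  exact add_le_add e₁ e₂

/-- On each closed cone `f` may be replaced by its continuous quadratic formula, so the graph is a
finite union of closed sets. -/
lemma isClosed_graph_subgradients [Finite ι] (H : IsConicPLQ T A D f) :
    IsClosed {z : E × E | z.2 ∈ subgradients D f z.1} := by
  have : {z : E × E | z.2 ∈ subgradients D f z.1} = ⋃ i, ({z : E × E | z.1 ∈ polyCone (T i)} ∩
      ⋂ y ∈ D, {z : E × E | 1 / 2 * ⟪z.1, A i z.1⟫ + ⟪z.2, y - z.1⟫ ≤ f y}) := by
    ext ⟨k, u⟩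
    simp only [Set.mem_iUnion, Set.mem_inter_iff, Set.mem_iInter]
    constructor
    · rintro ⟨hk, h⟩
      obtain ⟨i, hi⟩ := H.mem_iff.1 hk
      refine ⟨i, hi, fun y hy => ?_⟩
      have := h y hy
      rwa [H.eq i _ hi] at this
    · rintro ⟨i, hi, h⟩
      refine ⟨H.mem_iff.2 ⟨i, hi⟩, fun y hy => ?_⟩
      rw [H.eq i _ hi]
      exact h y hy
  rw [this]
  refine isClosed_iUnion_of_finite fun i => IsClosed.inter ?_ ?_
  · exact (isClosed_polyCone (T i)).preimage continuous_fst
  · exact isClosed_biInter fun y _ => isClosed_le (by fun_prop) continuous_const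

end IsConicPLQ

end ConicPLQ

/-! ### Lipschitz continuity from finitely many pieces. -/

section PiecewiseLipschitz

variable {E G : Type*} [NormedAddCommGroup E] [NormedAddCommGroup G]

/-- A mapping that is Lipschitz on each set of a finite closed cover is Lipschitz. -/
lemma lipschitzWith_of_finite_closed_cover [NormedSpace ℝ E] {ι : Type*} [Finite ι] {f : E → G} {D : ι → Set E}
    (hcover : ∀ w, ∃ i, w ∈ D i) (hclosed : ∀ i, IsClosed (D i)) {C : NNReal}
    (hlip : ∀ i, LipschitzOnWith C f (D i)) : LipschitzWith C f := by
  have hcont : Continuous f :=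
    (locallyFinite_of_finite D).continuous (Set.iUnion_eq_univ_iff.2 hcover) hclosed
      fun i => (hlip i).continuousOn
  refine LipschitzWith.of_dist_le_mul fun x y => ?_
  let w : ℝ → E := fun t => x + t • (y - x)
  have hw : Continuous w := by fun_prop
  have hdist : ∀ t t' : ℝ, t ≤ t' → dist (w t') (w t) = (t' - t) * dist x y := by
    intro t t' h
    have : w t' - w t = (t' - t) • (y - x) := by simp only [w]; module
    rw [dist_eq_norm, this, norm_smul, Real.norm_of_nonneg (sub_nonneg.2 h), dist_comm,
      dist_eq_norm]
  let s : Set ℝ := {t | dist (f (w t)) (f x) ≤ C * (t * dist x y)}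
  have hs : IsClosed s := isClosed_le (by fun_prop) (by fun_prop)
  -- Continuous induction along the segment: some `D i` contains points `w t'` with `t' > t`
  -- arbitrarily close, hence also `w t`, and its Lipschitz bound carries the estimate from `t` to
  -- `t'`.
  have hsub : Set.Icc (0 : ℝ) 1 ⊆ s := by
    refine (hs.inter isClosed_Icc).Icc_subset_of_forall_exists_gt (by simp [s, w]) ?_
    rintro t ⟨ht, ht0, -⟩ b hb
    have : ∀ᶠ t' in 𝓝[>] t, ∃ i, w t' ∈ D i := .of_forall fun t' => hcover _
    obtain ⟨i, hi⟩ := exists_frequently_of_eventually_exists this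
    have hti : w t ∈ D i := (hclosed i).mem_of_frequently_of_tendsto hi
      ((hw.tendsto t).mono_left nhdsWithin_le_nhds)
    obtain ⟨t', ht', hmem⟩ := (hi.and_eventually (Ioc_mem_nhdsGT hb)).exists
    refine ⟨t', ?_, hmem⟩
    have h1 := (hlip i).dist_le_mul _ ht' _ hti
    rw [hdist t t' hmem.1.le] at h1
    have h2 : dist (f (w t)) (f x) ≤ C * (t * dist x y) := ht
    change dist (f (w t')) (f x) ≤ C * (t' * dist x y)
    linarith [dist_triangle (f (w t')) (f (w t)) (f x)]
  have h1 : dist (f (w 1)) (f x) ≤ C * (1 * dist x y) := hsub ⟨zero_le_one, le_rfl⟩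
  have hw1 : w 1 = y := by simp [w]
  rwa [hw1, one_mul, dist_comm] at h1

/-- Along a sequence in `D` converging to `w` the values are Cauchy, and the closed graph identifies
their limit as `f w`; estimates then pass to the limit. -/
lemma lipschitzOnWith_closure_of_isClosed_graph [CompleteSpace G] {f : E → G}
    (hf : IsClosed {z : E × G | z.2 = f z.1}) {D : Set E} {C : NNReal}
    (hlip : LipschitzOnWith C f D) : LipschitzOnWith C f (closure D) := by
  have key : ∀ w ∈ closure D, ∃ x : ℕ → E, (∀ n, x n ∈ D) ∧ Tendsto x atTop (𝓝 w) ∧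
      Tendsto (fun n => f (x n)) atTop (𝓝 (f w)) := by
    intro w hw
    obtain ⟨x, hx, hxw⟩ := mem_closure_iff_seq_limit.1 hw
    refine ⟨x, hx, hxw, ?_⟩
    have hcau : CauchySeq fun n => f (x n) := by
      rw [Metric.cauchySeq_iff]
      intro ε hε
      obtain ⟨N, hN⟩ := Metric.cauchySeq_iff.1 hxw.cauchySeq (ε / (C + 1)) (by positivity)
      refine ⟨N, fun m hm n hn => ?_⟩
      have h1 := hlip.dist_le_mul _ (hx m) _ (hx n)
      have h2 := hN m hm n hn
      rw [lt_div_iff₀ (by positivity)] at h2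
      have : 0 ≤ dist (x m) (x n) := dist_nonneg
      linarith
    obtain ⟨z, hz⟩ := cauchySeq_tendsto_of_complete hcau
    have : (w, z) ∈ {z : E × G | z.2 = f z.1} :=
      hf.mem_of_tendsto (hxw.prodMk_nhds hz) (.of_forall fun n => rfl)
    rwa [show z = f w from this] at hz
  refine LipschitzOnWith.of_dist_le_mul fun v hv w hw => ?_
  obtain ⟨x, hx, hxv, hfx⟩ := key v hv
  obtain ⟨y, hy, hyw, hfy⟩ := key w hw
  exact le_of_tendsto_of_tendsto (hfx.dist hfy) ((hxv.dist hyw).const_mul _)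
    (.of_forall fun n => hlip.dist_le_mul _ (hx n) _ (hy n))

/-- A mapping that is additive and positively homogeneous on a convex cone in a finite-dimensional
space is Lipschitz on it. -/
lemma exists_lipschitzOnWith_of_conic [NormedSpace ℝ E] [NormedSpace ℝ G]
    [FiniteDimensional ℝ E] [FiniteDimensional ℝ G] {f : E → G}
    {D : Set E}
    (hf : ∀ v ∈ D, ∀ w ∈ D, ∀ α β : ℝ, 0 < α → 0 < β →
      α • v + β • w ∈ D ∧ f (α • v + β • w) = α • f v + β • f w) :
    ∃ C : NNReal, LipschitzOnWith C f D := by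
  rcases D.eq_empty_or_nonempty with rfl | ⟨v₀, hv₀⟩
  · exact ⟨0, by simp⟩
  -- Elements of the span of the graph are differences of two graph points, so the projection of `V`
  -- to `E` is injective. In finite dimension it is then antilipschitz, which bounds `f` on `D`.
  let V : Submodule ℝ (E × G) := Submodule.span ℝ ((fun w => (w, f w)) '' D)
  have hsmul : ∀ v ∈ D, ∀ c : ℝ, 0 < c → c • v ∈ D ∧ f (c • v) = c • f v := by
    intro v hv c hc
    have := hf v hv v hv (c / 2) (c / 2) (by positivity) (by positivity)
    rwa [← add_smul, ← add_smul, add_halves] at this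
  have hadd : ∀ v ∈ D, ∀ w ∈ D, v + w ∈ D ∧ f (v + w) = f v + f w := by
    intro v hv w hw
    simpa using hf v hv w hw 1 1 one_pos one_pos
  have hV : ∀ z ∈ V, ∃ v ∈ D, ∃ w ∈ D, z = (v - w, f v - f w) := by
    intro z hz
    induction hz using Submodule.span_induction with
    | mem z hz =>
      obtain ⟨v, hv, rfl⟩ := hz
      obtain ⟨h1, h2⟩ := hadd v hv v hv
      exact ⟨v + v, h1, v, hv, by simp [h2]⟩
    | zero => exact ⟨v₀, hv₀, v₀, hv₀, by rw [sub_self, sub_self]; rfl⟩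
    | add x y _ _ hx hy =>
      obtain ⟨v, hv, w, hw, rfl⟩ := hx
      obtain ⟨v', hv', w', hw', rfl⟩ := hy
      obtain ⟨h1, h2⟩ := hadd v hv v' hv'
      obtain ⟨h3, h4⟩ := hadd w hw w' hw'
      refine ⟨_, h1, _, h3, ?_⟩
      rw [h2, h4, Prod.mk_add_mk, add_sub_add_comm, add_sub_add_comm]
    | smul c x _ hx =>
      obtain ⟨v, hv, w, hw, rfl⟩ := hx
      rcases lt_trichotomy c 0 with hc | rfl | hc
      · obtain ⟨h1, h2⟩ := hsmul v hv (-c) (neg_pos.2 hc)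
        obtain ⟨h3, h4⟩ := hsmul w hw (-c) (neg_pos.2 hc)
        refine ⟨_, h3, _, h1, ?_⟩
        rw [h2, h4, Prod.smul_mk]
        congr 1 <;> module
      · exact ⟨v₀, hv₀, v₀, hv₀, by rw [zero_smul, sub_self, sub_self]; rfl⟩
      · obtain ⟨h1, h2⟩ := hsmul v hv c hc
        obtain ⟨h3, h4⟩ := hsmul w hw c hc
        refine ⟨_, h1, _, h3, ?_⟩
        rw [h2, h4, Prod.smul_mk, smul_sub, smul_sub]
  let π : V →ₗ[ℝ] E := LinearMap.fst ℝ E G ∘ₗ V.subtype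
  have hker : LinearMap.ker π = ⊥ := by
    rw [LinearMap.ker_eq_bot']
    rintro ⟨z, hz⟩ h0
    obtain ⟨v, hv, w, hw, rfl⟩ := hV z hz
    have hvw : v - w = 0 := h0
    have : v = w := sub_eq_zero.1 hvw
    subst this
    simp
  obtain ⟨K, -, hK⟩ := π.exists_antilipschitzWith hker
  refine ⟨K, LipschitzOnWith.of_dist_le_mul fun v hv w hw => ?_⟩
  have hmem : ∀ v ∈ D, (v, f v) ∈ V := fun v hv => Submodule.subset_span ⟨v, hv, rfl⟩
  have := hK.le_mul_dist ⟨_, hmem v hv⟩ ⟨_, hmem w hw⟩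
  refine le_trans ?_ this
  rw [Subtype.dist_eq, Prod.dist_eq]
  exact le_max_right _ _

end PiecewiseLipschitz

/-! ### The Lipschitz inverse of `M + ∂f`. -/

section Inverse

variable {E : Type*} [NormedAddCommGroup E] [InnerProductSpace ℝ E] [FiniteDimensional ℝ E]

/-- If `f` is piecewise quadratic on cones and `M + ∂f` has a single-valued inverse, then this
inverse is Lipschitz continuous. -/
theorem IsConicPLQ.exists_lipschitzWith_inverse {ι : Type*} [Finite ι] {T : ι → Finset E}
    {A : ι → E →L[ℝ] E} {D : Set E} {f : E → ℝ} (H : IsConicPLQ T A D f) (M : E →L[ℝ] E)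
    {ξ : E → E} (hξ : ∀ w k, w - M k ∈ subgradients D f k ↔ k = ξ w) :
    ∃ C : NNReal, LipschitzWith C ξ := by
  -- There are finitely many sign patterns; on the set `P c` of points whose image has pattern `c`,
  -- `ξ` is additive and positively homogeneous.
  let pat : E → (i : ι) → T i → SignType := fun k i a => SignType.sign ⟪(a : E), k⟫
  let P : ((i : ι) → T i → SignType) → Set E := fun c => {w | pat (ξ w) = c}
  have hgraph : IsClosed {z : E × E | z.2 = ξ z.1} := by
    have h1 : {z : E × E | z.2 = ξ z.1} =
        (fun z : E × E => (z.2, z.1 - M z.2)) ⁻¹' {z | z.2 ∈ subgradients D f z.1} := by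
      ext z; exact (hξ _ _).symm
    rw [h1]
    exact H.isClosed_graph_subgradients.preimage (by fun_prop)
  have hlip : ∀ c, ∃ C : NNReal, LipschitzOnWith C ξ (P c) := by
    intro c
    refine exists_lipschitzOnWith_of_conic fun v hv w hw α β hα hβ => ?_
    have hs : ∀ i, ∀ a ∈ T i, SignType.sign ⟪a, ξ v⟫ = SignType.sign ⟪a, ξ w⟫ := by
      intro i a ha
      have h1 : pat (ξ v) = pat (ξ w) := Eq.trans hv (Eq.symm hw)
      exact congrFun (congrFun h1 i) ⟨a, ha⟩
    have hmem := H.combo_mem_subgradients hs ((hξ v _).2 rfl) ((hξ w _).2 rfl) hα hβ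
    have heq : α • ξ v + β • ξ w = ξ (α • v + β • w) := by
      rw [← hξ]
      convert hmem using 1
      rw [map_add, map_smul, map_smul]
      module
    refine ⟨?_, heq.symm⟩
    change pat (ξ (α • v + β • w)) = c
    rw [← heq, ← show pat (ξ v) = c from hv]
    funext i a
    simp only [pat, inner_add_right, inner_smul_right]
    exact sign_combo (hs i a a.2) hα hβ
  choose C hC using hlip
  have hfin : Fintype ((i : ι) → T i → SignType) := by
    classical
    have := Fintype.ofFinite ι
    infer_instance
  refine ⟨∑ c, C c, lipschitzWith_of_finite_closed_cover (D := fun c => closure (P c))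
    (fun w => ⟨pat (ξ w), subset_closure rfl⟩) (fun c => isClosed_closure) fun c => ?_⟩
  exact (lipschitzOnWith_closure_of_isClosed_graph hgraph (hC c)).weaken
    (Finset.single_le_sum (f := C) (fun _ _ => zero_le) (Finset.mem_univ c))

end Inverse

/-! ### Reduction of subgradients near the origin to the second-order part. -/

section LocalReduction

variable {E : Type*} [NormedAddCommGroup E] [InnerProductSpace ℝ E]

/-- A nonnegative convex function that is, on a ball around `0`, piecewise linear-quadratic without
constant terms, the pieces being polyhedral cones. -/
structure IsLocallyPLQ {ι : Type*} (T : ι → Finset E) (A : ι → E →L[ℝ] E) (b : ι → E) (D : Set E)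
    (g : E → ℝ) (r : ℝ) : Prop where
  pos : 0 < r
  mem_iff : ∀ k, ‖k‖ < r → (k ∈ D ↔ ∃ i, k ∈ polyCone (T i))
  eq : ∀ i k, ‖k‖ < r → k ∈ polyCone (T i) → g k = 1 / 2 * ⟪k, A i k⟫ + ⟪b i, k⟫
  symm : ∀ i x y, ⟪A i x, y⟫ = ⟪x, A i y⟫
  nonneg : ∀ k ∈ D, 0 ≤ g k
  convex : ConvexOn ℝ D g

open Classical in
/-- The constraints describing the faces `K i ∩ (b i)^⊥` of the cones `K i = polyCone (T i)`, given
that `b i` is nonnegative on `K i`. -/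
noncomputable def faceConstraints {ι : Type*} (T : ι → Finset E) (b : ι → E) (i : ι) : Finset E :=
  insert (b i) (T i)

lemma exists_forall_norm_smul_lt (k : E) {r : ℝ} (hr : 0 < r) :
    ∃ t₀ : ℝ, 0 < t₀ ∧ ∀ t, 0 < t → t ≤ t₀ → ‖t • k‖ < r := by
  have hk := norm_nonneg k
  refine ⟨r / (‖k‖ + 1), by positivity, fun t ht htt => ?_⟩
  rw [norm_smul, Real.norm_of_nonneg ht.le]
  rw [le_div_iff₀ (by positivity)] at htt
  linarith

lemma quadratic_smul (A : E →L[ℝ] E) (k : E) (t : ℝ) :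
    1 / 2 * ⟪t • k, A (t • k)⟫ = t * (t * (1 / 2 * ⟪k, A k⟫)) := by
  rw [map_smul, inner_smul_left, inner_smul_right, RCLike.conj_to_real]; ring

namespace IsLocallyPLQ

variable {ι : Type*} {T : ι → Finset E} {A : ι → E →L[ℝ] E} {b : ι → E} {D : Set E} {g : E → ℝ}
  {r : ℝ}

/-- Divide `g (t • k) ≥ 0` by `t` and let `t ↘ 0`. -/
lemma inner_nonneg (H : IsLocallyPLQ T A b D g r) {i : ι} {k : E} (hk : k ∈ polyCone (T i)) :
    0 ≤ ⟪b i, k⟫ := by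
  obtain ⟨t₀, ht₀, hsmall⟩ := exists_forall_norm_smul_lt k H.pos
  refine le_of_forall_small ht₀ (c := 1 / 2 * ⟪k, A i k⟫) fun t ht htt => ?_
  have hmem := smul_mem_polyCone hk ht.le
  have hn := hsmall t ht htt
  have := H.nonneg _ ((H.mem_iff _ hn).2 ⟨i, hmem⟩)
  rw [H.eq i _ hn hmem, quadratic_smul, inner_smul_right, ← mul_add] at this
  linarith [nonneg_of_mul_nonneg_right this ht]

lemma mem_faceConstraints (H : IsLocallyPLQ T A b D g r) {i : ι} {k : E} :
    k ∈ polyCone (faceConstraints T b i) ↔ k ∈ polyCone (T i) ∧ ⟪b i, k⟫ = 0 := by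
  classical
  rw [faceConstraints, mem_polyCone_insert, and_comm]
  refine and_congr_right fun hk => ⟨fun h => le_antisymm h (H.inner_nonneg hk), fun h => h.le⟩

/-- The second-order part of a locally piecewise linear-quadratic function is convex. -/
lemma isConicPLQ (H : IsLocallyPLQ T A b D g r) {D' : Set E} {f : E → ℝ}
    (hD' : D' = ⋃ i, polyCone (faceConstraints T b i))
    (hf : ∀ i, ∀ k ∈ polyCone (faceConstraints T b i), f k = 1 / 2 * ⟪k, A i k⟫) :
    IsConicPLQ (faceConstraints T b) A D' f := by
  have key : ∀ x ∈ D', ∀ y ∈ D', ∀ α β : ℝ, 0 ≤ α → 0 ≤ β → α + β = 1 →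
      α • x + β • y ∈ D' ∧ f (α • x + β • y) ≤ α * f x + β * f y := by
    intro x hx y hy α β hα hβ hαβ
    rw [hD', Set.mem_iUnion] at hx hy
    obtain ⟨i, hxi⟩ := hx
    obtain ⟨j, hyj⟩ := hy
    have hg : ∀ i, ∀ x ∈ polyCone (faceConstraints T b i), ∀ t : ℝ, 0 < t → ‖t • x‖ < r →
        t • x ∈ D ∧ g (t • x) = t * (t * f x) := by
      intro i x hxi t ht htx
      have h1 := H.mem_faceConstraints.1 hxi
      have h2 := smul_mem_polyCone h1.1 ht.le
      refine ⟨(H.mem_iff _ htx).2 ⟨i, h2⟩, ?_⟩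
      rw [H.eq i _ htx h2, inner_smul_right, h1.2, quadratic_smul, hf i x hxi]
      ring
    obtain ⟨t₁, ht₁, hx⟩ := exists_forall_norm_smul_lt x H.pos
    obtain ⟨t₂, ht₂, hy⟩ := exists_forall_norm_smul_lt y H.pos
    obtain ⟨t₃, ht₃, hz⟩ := exists_forall_norm_smul_lt (α • x + β • y) H.pos
    set z := α • x + β • y with hzdef
    set t₀ := min t₁ (min t₂ t₃) with ht₀def
    have ht₀ : 0 < t₀ := lt_min ht₁ (lt_min ht₂ ht₃)
    have hconv : ∀ t, 0 < t → t ≤ t₀ → t • z ∈ D ∧ g (t • z) ≤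
        t * (t * (α * f x + β * f y)) := by
      intro t ht htt
      obtain ⟨h1, h2⟩ := hg i x hxi t ht (hx t ht (htt.trans (min_le_left _ _)))
      obtain ⟨h3, h4⟩ := hg j y hyj t ht
        (hy t ht (htt.trans ((min_le_right _ _).trans (min_le_left _ _))))
      have heq : t • z = α • (t • x) + β • (t • y) := by rw [hzdef]; module
      rw [heq]
      refine ⟨H.convex.1 h1 h3 hα hβ hαβ, (H.convex.2 h1 h3 hα hβ hαβ).trans ?_⟩
      rw [h2, h4, smul_eq_mul, smul_eq_mul]
      linarith
    have hzr : ∀ t, 0 < t → t ≤ t₀ → ‖t • z‖ < r := fun t ht htt =>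
      hz t ht (htt.trans ((min_le_right _ _).trans (min_le_right _ _)))
    obtain ⟨l, hl⟩ := (H.mem_iff _ (hzr t₀ ht₀ le_rfl)).1 (hconv t₀ ht₀ le_rfl).1
    rw [smul_mem_polyCone_iff ht₀] at hl
    have hgz : ∀ t, 0 < t → t ≤ t₀ → g (t • z) = t * (t * (1 / 2 * ⟪z, A l z⟫) + ⟪b l, z⟫) := by
      intro t ht htt
      rw [H.eq l _ (hzr t ht htt) (smul_mem_polyCone hl ht.le), quadratic_smul, inner_smul_right]
      ring
    -- Convexity of `g` bounds `g (t • z)` by a multiple of `t²`, which rules out a positive linear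
    -- term; thus `z` lies in a face, and dividing by `t²` gives convexity of `f`.
    have hbz : ⟪b l, z⟫ ≤ 0 := by
      refine le_of_forall_small ht₀ (c := α * f x + β * f y - 1 / 2 * ⟪z, A l z⟫)
        fun t ht htt => ?_
      have := (hconv t ht htt).2
      rw [hgz t ht htt] at this
      have := le_of_mul_le_mul_left this ht
      linarith
    have hbz0 : ⟪b l, z⟫ = 0 := le_antisymm hbz (H.inner_nonneg hl)
    have hzl := H.mem_faceConstraints.2 ⟨hl, hbz0⟩
    refine ⟨by rw [hD', Set.mem_iUnion]; exact ⟨l, hzl⟩, ?_⟩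
    have := (hconv t₀ ht₀ le_rfl).2
    rw [hgz t₀ ht₀ le_rfl, hbz0, add_zero, ← hf l z hzl] at this
    exact le_of_mul_le_mul_left (le_of_mul_le_mul_left this ht₀) ht₀
  exact ⟨hD', hf, H.symm, fun x hx y hy α β hα hβ hαβ => (key x hx y hy α β hα hβ hαβ).1,
    fun x hx y hy α β hα hβ hαβ => (key x hx y hy α β hα hβ hαβ).2⟩

lemma quadratic_sub_ge {A : E →L[ℝ] E} (hA : ∀ x y, ⟪A x, y⟫ = ⟪x, A y⟫) (y y' : E) :
    1 / 2 * ⟪y', A y'⟫ - 1 / 2 * (‖A‖ * (‖y‖ + ‖y'‖)) * ‖y - y'‖ ≤ 1 / 2 * ⟪y, A y⟫ := by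
  have h1 : ⟪y, A y⟫ - ⟪y', A y'⟫ = ⟪y - y', A (y + y')⟫ := by
    have : ⟪y', A y⟫ = ⟪y, A y'⟫ := by rw [← hA, real_inner_comm]
    simp only [map_add, inner_add_right, inner_sub_left, this]
    ring
  have h2 : -⟪y - y', A (y + y')⟫ ≤ ‖y - y'‖ * (‖A‖ * (‖y‖ + ‖y'‖)) := by
    refine (neg_le_abs _).trans ((abs_real_inner_le_norm _ _).trans ?_)
    gcongr
    exact (A.le_opNorm _).trans (by gcongr; exact norm_add_le _ _)
  linarith

/-- Points of a cone near `0` can be moved to the face `K i ∩ (b i)^⊥` with a decrease of the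
function that dominates small linear perturbations. -/
lemma exists_move_to_face [FiniteDimensional ℝ E] [Finite ι] (H : IsLocallyPLQ T A b D g r) :
    ∃ δ : ℝ, 0 < δ ∧ δ < r ∧ ∀ i, ∀ y ∈ polyCone (T i), ‖y‖ < δ → ∀ u : E, ‖u‖ < δ →
      ∃ y' ∈ polyCone (faceConstraints T b i), ‖y'‖ < r ∧
        1 / 2 * ⟪y', A i y'⟫ + ⟪u, y - y'⟫ + 1 / 2 * ⟪b i, y⟫ ≤
          1 / 2 * ⟪y, A i y⟫ + ⟪b i, y⟫ := by
  have hC := fun i => exists_error_bound (T i) (b i) fun y hy => H.inner_nonneg hy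
  choose C hC0 hC using hC
  have hlim : ∀ c d : ℝ, 0 < d → ∀ᶠ δ : ℝ in 𝓝[>] 0, c * δ < d := by
    intro c d hd
    have : Tendsto (fun δ : ℝ => c * δ) (𝓝 0) (𝓝 (c * 0)) := by
      apply Continuous.tendsto; fun_prop
    rw [mul_zero] at this
    exact (this.mono_left nhdsWithin_le_nhds).eventually_lt_const hd
  -- The first bound keeps `y'` in the ball. In the second, the quadratic change and `⟪u, y - y'⟫`
  -- are `O(δ) ‖y - y'‖`, and `‖y - y'‖ ≤ C i * ⟪b i, y⟫`, so together they use at most half of `⟪b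
  -- i, y⟫`.
  have hev : ∀ᶠ δ : ℝ in 𝓝[>] 0, ∀ i, (1 + C i * ‖b i‖) * δ < r ∧
      ((1 / 2 * (‖A i‖ * (2 + C i * ‖b i‖)) + 1) * C i) * δ < 1 / 2 :=
    eventually_all.2 fun i => (hlim _ _ H.pos).and (hlim _ _ one_half_pos)
  obtain ⟨δ, ⟨hδ, hδr⟩, hδ0⟩ :=
    ((hev.and (hlim 1 r H.pos)).and self_mem_nhdsWithin).exists
  rw [one_mul] at hδr
  replace hδ0 : 0 < δ := hδ0
  refine ⟨δ, hδ0, hδr, fun i y hy hyδ u hu => ?_⟩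
  obtain ⟨h1, h2⟩ := hδ i
  obtain ⟨y', hy', hby', hdist⟩ := hC i y hy
  have hb := H.inner_nonneg hy
  have hbδ : ⟪b i, y⟫ ≤ ‖b i‖ * δ :=
    (real_inner_le_norm _ _).trans (mul_le_mul_of_nonneg_left hyδ.le (norm_nonneg _))
  have hCb := mul_le_mul_of_nonneg_left hbδ (hC0 i)
  have hy'n : ‖y'‖ ≤ (1 + C i * ‖b i‖) * δ := by
    have : ‖y'‖ ≤ ‖y‖ + ‖y - y'‖ := by
      have := norm_sub_le y (y - y')
      rwa [sub_sub_cancel] at this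
    linarith
  refine ⟨y', H.mem_faceConstraints.2 ⟨hy', hby'⟩, hy'n.trans_lt h1, ?_⟩
  have hq := quadratic_sub_ge (H.symm i) y y'
  have hu' : ⟪u, y - y'⟫ ≤ δ * ‖y - y'‖ :=
    (real_inner_le_norm _ _).trans (mul_le_mul_of_nonneg_right hu.le (norm_nonneg _))
  have hA : 1 / 2 * (‖A i‖ * (‖y‖ + ‖y'‖)) * ‖y - y'‖ ≤
      1 / 2 * (‖A i‖ * ((2 + C i * ‖b i‖) * δ)) * ‖y - y'‖ := by
    gcongr
    linarith
  have hfin : (1 / 2 * (‖A i‖ * ((2 + C i * ‖b i‖) * δ)) + δ) * ‖y - y'‖ ≤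
      (1 / 2 * (‖A i‖ * ((2 + C i * ‖b i‖) * δ)) + δ) * (C i * ⟪b i, y⟫) := by
    have := hC0 i
    gcongr
  have h3 := mul_le_mul_of_nonneg_right h2.le hb
  linarith

/-- Near the origin, the subgradients of a locally piecewise linear-quadratic function are those of
its second-order part. -/
theorem exists_mem_subgradients_iff [FiniteDimensional ℝ E] [Finite ι]
    (H : IsLocallyPLQ T A b D g r) {D' : Set E} {f : E → ℝ}
    (H' : IsConicPLQ (faceConstraints T b) A D' f) :
    ∃ ε : ℝ, 0 < ε ∧ ∀ k u : E, ‖k‖ < ε → ‖u‖ < ε →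
      (u ∈ subgradients D g k ↔ u ∈ subgradients D' f k) := by
  obtain ⟨δ, hδ0, hδr, hδ⟩ := H.exists_move_to_face
  have hface : ∀ i, ∀ y ∈ polyCone (faceConstraints T b i), ‖y‖ < r → y ∈ D ∧ g y = f y := by
    intro i y hy hyr
    have h1 := H.mem_faceConstraints.1 hy
    exact ⟨(H.mem_iff _ hyr).2 ⟨i, h1.1⟩,
      by rw [H.eq i _ hyr h1.1, h1.2, add_zero, H'.eq i _ hy]⟩
  refine ⟨δ / 2, half_pos hδ0, fun k u hk hu => ?_⟩
  have hkδ : ‖k‖ < δ := by linarith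
  have huδ : ‖u‖ < δ := by linarith
  have hnear : ∀ y, ‖y - k‖ < δ / 2 → ‖y‖ < δ := by
    intro y hy
    have := norm_add_le (y - k) k
    rw [sub_add_cancel] at this
    linarith
  constructor
  · rintro ⟨hkD, hu'⟩
    obtain ⟨i, hki⟩ := (H.mem_iff _ (hkδ.trans hδr)).1 hkD
    -- Testing the subgradient inequality at the moved point `k'` leaves `½⟪b i, k⟫ ≤ 0`, so `k`
    -- already lies in the face.
    have hkf : k ∈ polyCone (faceConstraints T b i) := by
      obtain ⟨k', hk', hk'r, hle⟩ := hδ i k hki hkδ u huδ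
      obtain ⟨hk'D, hgk'⟩ := hface i k' hk' hk'r
      have := hu' k' hk'D
      rw [hgk', H'.eq i _ hk', H.eq i _ (hkδ.trans hδr) hki, inner_sub_right] at this
      rw [inner_sub_right] at hle
      exact H.mem_faceConstraints.2 ⟨hki, le_antisymm (by linarith) (H.inner_nonneg hki)⟩
    refine mem_subgradients_of_local H'.convex (half_pos hδ0) (H'.mem_iff.2 ⟨i, hkf⟩)
      fun y hy hyk => ?_
    obtain ⟨j, hj⟩ := H'.mem_iff.1 hy
    obtain ⟨hyD, hgy⟩ := hface j y hj ((hnear y hyk).trans hδr)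
    rw [← hgy, ← (hface i k hkf (hkδ.trans hδr)).2]
    exact hu' y hyD
  · rintro ⟨hkD, hu'⟩
    obtain ⟨i, hki⟩ := H'.mem_iff.1 hkD
    obtain ⟨hkD, hgk⟩ := hface i k hki (hkδ.trans hδr)
    refine mem_subgradients_of_local H.convex (half_pos hδ0) hkD fun y hy hyk => ?_
    have hyδ := hnear y hyk
    obtain ⟨j, hj⟩ := (H.mem_iff _ (hyδ.trans hδr)).1 hy
    -- The inequality holds at the face point `y'`; the gain in moving from `y` to `y'` covers `⟪u,
    -- y - y'⟫`.
    obtain ⟨y', hy', hy'r, hle⟩ := hδ j y hj hyδ u huδ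
    have h1 := hu' y' (H'.mem_iff.2 ⟨j, hy'⟩)
    rw [H'.eq j _ hy', inner_sub_right] at h1
    rw [hgk, H.eq j _ (hyδ.trans hδr) hj, inner_sub_right]
    rw [inner_sub_right] at hle
    linarith [H.inner_nonneg hj]

end IsLocallyPLQ

end LocalReduction

/-! ### From extended-real-valued `q` to the local real-valued model. -/

section ExtendedReal

variable {E : Type*} [NormedAddCommGroup E] [InnerProductSpace ℝ E]

lemma mem_subdifferential_iff {φ : E → EReal} (hφ : ∀ x, φ x ≠ ⊥) {x v : E} :
    v ∈ subdifferential φ x ↔ v ∈ subgradients (effDomain φ) (fun y => (φ y).toReal) x := by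
  constructor
  · rintro ⟨-, htop, h⟩
    refine ⟨lt_top_iff_ne_top.2 htop, fun y hy => ?_⟩
    have := h y
    rw [← EReal.coe_toReal htop (hφ x), ← EReal.coe_toReal (lt_top_iff_ne_top.1 hy) (hφ y)] at this
    exact_mod_cast this
  · rintro ⟨hx, h⟩
    refine ⟨hφ x, hx.ne, fun y => ?_⟩
    rcases eq_or_ne (φ y) ⊤ with hy | hy
    · rw [hy]; exact le_top
    · have := h y (lt_top_iff_ne_top.2 hy)
      rw [← EReal.coe_toReal hx.ne (hφ x), ← EReal.coe_toReal hy (hφ y)]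
      exact_mod_cast this

/-- The effective domain of `k ↦ q (x + k)`. -/
def shiftedDomain (q : E → EReal) (x : E) : Set E := {k | q (x + k) < ⊤}

/-- The real-valued function `k ↦ q (x + k) - q x - ⟪v, k⟫` (meaningful on `shiftedDomain q x`). -/
def tiltedIncrement (q : E → EReal) (x v k : E) : ℝ :=
  (q (x + k)).toReal - (q x).toReal - ⟪v, k⟫

lemma add_mem_subdifferential_iff {q : E → EReal} (hq : ∀ x, q x ≠ ⊥) {x v k u : E} :
    v + u ∈ subdifferential q (x + k) ↔
      u ∈ subgradients (shiftedDomain q x) (tiltedIncrement q x v) k := by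
  rw [mem_subdifferential_iff hq]
  refine and_congr Iff.rfl ⟨fun h y hy => ?_, fun h y hy => ?_⟩
  · have := h (x + y) hy
    simp only [tiltedIncrement]
    rw [add_sub_add_left_eq_sub, inner_add_left, inner_sub_right] at this
    linarith
  · have hxy : x + (y - x) = y := by abel
    have := h (y - x) (show q (x + (y - x)) < ⊤ by rwa [hxy])
    simp only [tiltedIncrement, hxy] at this
    rw [sub_add_eq_sub_sub, inner_add_left, inner_sub_right v]
    linarith

lemma secondDiffQuotient_eq_coe {q : E → EReal} (hq : ∀ x, q x ≠ ⊥) {x v w : E} {τ : ℝ}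
    (hx : q x ≠ ⊤) (hw : τ • w ∈ shiftedDomain q x) :
    secondDiffQuotient q x v τ w =
      (((1 / 2 * τ ^ 2)⁻¹ * tiltedIncrement q x v (τ • w) : ℝ) : EReal) := by
  rw [secondDiffQuotient, tiltedIncrement, inner_smul_right]
  rw [← EReal.coe_toReal hx (hq x), ← EReal.coe_toReal (ne_of_lt hw) (hq (x + τ • w))]
  simp only [EReal.toReal_coe]
  norm_cast

lemma secondDiffQuotient_eq_top {q : E → EReal} (hq : ∀ x, q x ≠ ⊥) {x v w : E} {τ : ℝ}
    (hτ : 0 < τ) (hx : q x ≠ ⊤) (hw : τ • w ∉ shiftedDomain q x) :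
    secondDiffQuotient q x v τ w = ⊤ := by
  have htop : q (x + τ • w) = ⊤ := by simpa [shiftedDomain] using hw
  rw [secondDiffQuotient, htop, ← EReal.coe_toReal hx (hq x), EReal.top_sub_coe, EReal.top_sub_coe]
  exact EReal.coe_mul_top_of_pos (by positivity)

lemma convexOn_tiltedIncrement {q : E → EReal} (hq : ∀ x, q x ≠ ⊥) (hconvex : IsConvexFun q)
    (x v : E) : ConvexOn ℝ (shiftedDomain q x) (tiltedIncrement q x v) := by
  have key : ∀ k ∈ shiftedDomain q x, ∀ l ∈ shiftedDomain q x, ∀ α β : ℝ, 0 ≤ α → 0 ≤ β →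
      α + β = 1 → q (x + (α • k + β • l)) ≤
        ((α * (q (x + k)).toReal + β * (q (x + l)).toReal : ℝ) : EReal) := by
    intro k hk l hl α β hα hβ hαβ
    have hk' : (x + k, (q (x + k)).toReal) ∈ {z : E × ℝ | q z.1 ≤ (z.2 : EReal)} :=
      EReal.le_coe_toReal (ne_of_lt hk)
    have hl' : (x + l, (q (x + l)).toReal) ∈ {z : E × ℝ | q z.1 ≤ (z.2 : EReal)} :=
      EReal.le_coe_toReal (ne_of_lt hl)
    have h : q (α • (x + k) + β • (x + l)) ≤
        ((α • (q (x + k)).toReal + β • (q (x + l)).toReal : ℝ) : EReal) :=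
      hconvex hk' hl' hα hβ hαβ
    have heq : α • (x + k) + β • (x + l) = x + (α • k + β • l) := by
      rw [smul_add, smul_add, add_add_add_comm, ← add_smul, hαβ, one_smul]
    rwa [heq] at h
  refine ⟨fun k hk l hl α β hα hβ hαβ => ?_, fun k hk l hl α β hα hβ hαβ => ?_⟩
  · exact (key k hk l hl α β hα hβ hαβ).trans_lt (EReal.coe_lt_top _)
  · have h := EReal.toReal_le_toReal (key k hk l hl α β hα hβ hαβ) (hq _) (EReal.coe_ne_top _)
    rw [EReal.toReal_coe] at h
    simp only [tiltedIncrement, inner_add_right, inner_smul_right, smul_eq_mul]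
    have : (q x).toReal = α * (q x).toReal + β * (q x).toReal := by rw [← add_mul, hαβ, one_mul]
    linarith

lemma tiltedIncrement_nonneg {q : E → EReal} {x v k : E} (hv : v ∈ subdifferential q x)
    (hq : ∀ x, q x ≠ ⊥) (hk : k ∈ shiftedDomain q x) : 0 ≤ tiltedIncrement q x v k := by
  have := ((mem_subdifferential_iff hq).1 hv).2 (x + k) hk
  rw [add_sub_cancel_left] at this
  rw [tiltedIncrement]
  linarith

lemma isClosed_of_isPolyhedral {C : Set E} (hC : IsPolyhedral C) : IsClosed C := by
  obtain ⟨N, a, β, rfl⟩ := hC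
  rw [Set.ofPred_forall]
  exact isClosed_iInter fun i => isClosed_le (by fun_prop) continuous_const

/-- Near one of its points, a polyhedral set coincides with a translated polyhedral cone. -/
lemma exists_polyCone_of_isPolyhedral {C : Set E} (hC : IsPolyhedral C) {x : E} (hx : x ∈ C) :
    ∃ T : Finset E, ∀ᶠ k in 𝓝 (0 : E), (x + k ∈ C ↔ k ∈ polyCone T) := by
  classical
  obtain ⟨N, a, β, rfl⟩ := hC
  -- Only the constraints active at `x` matter locally.
  refine ⟨(Finset.univ.filter fun l => ⟪a l, x⟫ = β l).image a, ?_⟩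
  have hev : ∀ᶠ k in 𝓝 (0 : E), ∀ l, ⟪a l, x⟫ ≠ β l → ⟪a l, x + k⟫ < β l := by
    refine eventually_all.2 fun l => ?_
    by_cases hl : ⟪a l, x⟫ = β l
    · exact .of_forall fun k h => absurd hl h
    · have hlim : Tendsto (fun k : E => ⟪a l, x + k⟫) (𝓝 0) (𝓝 ⟪a l, x + 0⟫) := by
        apply Continuous.tendsto; fun_prop
      rw [add_zero] at hlim
      exact (hlim.eventually_lt_const (lt_of_le_of_ne (hx l) hl)).mono fun k h _ => h
  filter_upwards [hev] with k hk
  constructor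
  · intro h c hc
    obtain ⟨l, hl, rfl⟩ := Finset.mem_image.1 hc
    have h1 := h l
    have h2 : ⟪a l, x⟫ = β l := (Finset.mem_filter.1 hl).2
    rw [inner_add_right] at h1
    linarith
  · intro h l
    by_cases hl : ⟪a l, x⟫ = β l
    · have := h (a l) (Finset.mem_image.2 ⟨l, by simpa using hl, rfl⟩)
      rw [inner_add_right]
      linarith
    · exact (hk l hl).le

variable [FiniteDimensional ℝ E]

/-- The local structure of a convex piecewise linear-quadratic function. -/
lemma exists_isLocallyPLQ {q : E → EReal} (hq : ∀ x, q x ≠ ⊥) (hconvex : IsConvexFun q)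
    (hplq : IsPiecewiseLinearQuadratic q) {x v : E} (hv : v ∈ subdifferential q x) :
    ∃ (ι : Type) (_ : Finite ι) (T : ι → Finset E) (A : ι → E →L[ℝ] E) (b : ι → E) (r : ℝ),
      IsLocallyPLQ T A b (shiftedDomain q x) (tiltedIncrement q x v) r := by
  obtain ⟨N, C, hC, hdom, hquad⟩ := hplq
  choose A a α hA hquad using hquad
  have hT : ∀ i : {i // x ∈ C i}, ∃ T : Finset E,
      ∀ᶠ k in 𝓝 (0 : E), (x + k ∈ C i ↔ k ∈ polyCone T) :=
    fun i => exists_polyCone_of_isPolyhedral (hC i) i.2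
  choose T hT using hT
  have hfar : ∀ᶠ k in 𝓝 (0 : E), ∀ i, x ∉ C i → x + k ∉ C i := by
    refine eventually_all.2 fun i => ?_
    by_cases hi : x ∈ C i
    · exact .of_forall fun k h => absurd hi h
    · have hlim : Tendsto (fun k : E => x + k) (𝓝 0) (𝓝 (x + 0)) := by
        apply Continuous.tendsto; fun_prop
      rw [add_zero] at hlim
      exact (hlim.eventually ((isClosed_of_isPolyhedral (hC i)).isOpen_compl.mem_nhds hi)).mono
        fun k h _ => h
  obtain ⟨r, hr, hball⟩ := Metric.eventually_nhds_iff.1 (hfar.and (eventually_all.2 hT))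
  simp only [dist_zero_right] at hball
  -- Only pieces through `x` count. Expanding each about `x` cancels the constants, and `b i` is the
  -- gradient of the piece at `x` minus `v`.
  refine ⟨{i // x ∈ C i}, inferInstance, T, fun i => LinearMap.toContinuousLinearMap (A i),
    fun i => A i x + a i - v, r, hr, fun k hk => ?_, fun i k hk hki => ?_,
    fun i => hA i, fun k hk => tiltedIncrement_nonneg hv hq hk,
    convexOn_tiltedIncrement hq hconvex x v⟩
  · obtain ⟨h1, h2⟩ := hball hk
    have : k ∈ shiftedDomain q x ↔ x + k ∈ effDomain q := Iff.rfl
    rw [this, hdom, Set.mem_iUnion]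
    constructor
    · rintro ⟨i, hi⟩
      have hxi : x ∈ C i := by
        by_contra hxi
        exact h1 i hxi hi
      exact ⟨⟨i, hxi⟩, (h2 ⟨i, hxi⟩).1 hi⟩
    · rintro ⟨i, hi⟩
      exact ⟨i, (h2 i).2 hi⟩
  · have hmem := ((hball hk).2 i).2 hki
    rw [tiltedIncrement, hquad i _ hmem, hquad i _ i.2, EReal.toReal_coe, EReal.toReal_coe]
    have h1 : ⟪k, A i x⟫ = ⟪A i x, k⟫ := real_inner_comm _ _
    have h2 : ⟪x, A i k⟫ = ⟪A i x, k⟫ := (hA i x k).symm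
    simp only [LinearMap.coe_toContinuousLinearMap', map_add, inner_add_left, inner_add_right,
      inner_sub_left, h1, h2]
    ring

end ExtendedReal

/-! ### Computation of the second-order subderivative. -/

section SecondSubderivative

variable {E : Type*} [NormedAddCommGroup E] [InnerProductSpace ℝ E]
  {ι : Type*} {T : ι → Finset E} {A : ι → E →L[ℝ] E} {b : ι → E} {q : E → EReal} {x v : E} {r : ℝ}

lemma tendsto_fst_smul_snd (k : E) :
    Tendsto (fun z : ℝ × E => z.1 • z.2) (𝓝[>] (0 : ℝ) ×ˢ 𝓝 k) (𝓝 0) := by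
  have : Tendsto (fun z : ℝ × E => z.1 • z.2) (𝓝 (0, k)) (𝓝 ((0 : ℝ) • k)) :=
    Continuous.tendsto (by fun_prop : Continuous fun z : ℝ × E => z.1 • z.2) (0, k)
  rw [zero_smul] at this
  refine this.mono_left ?_
  rw [nhds_prod_eq]
  exact Filter.prod_mono nhdsWithin_le_nhds le_rfl

/-- On a piece the quotient is `⟪w, A i w⟫ + 2⟪b i, w⟫ / τ`. As `w → k` it blows up if `⟪b i, k⟫ >
0`, and is at least `⟪w, A i w⟫` if `⟪b i, k⟫ = 0`; pieces not containing `k` are avoided. If `k` is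
in no face, `hc` is vacuous, so every real `c` is a lower bound. -/
lemma IsLocallyPLQ.le_secondSubderivative [Finite ι] (hq : ∀ x, q x ≠ ⊥) (hx : q x ≠ ⊤)
    (H : IsLocallyPLQ T A b (shiftedDomain q x) (tiltedIncrement q x v) r) {k : E} {c : ℝ}
    (hc : ∀ i, k ∈ polyCone (faceConstraints T b i) → c < ⟪k, A i k⟫) :
    (c : EReal) ≤ secondSubderivative q x v k := by
  have hle : 𝓝[>] (0 : ℝ) ×ˢ 𝓝 k ≤ 𝓝 ((0 : ℝ), k) := by
    rw [nhds_prod_eq]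
    exact Filter.prod_mono nhdsWithin_le_nhds le_rfl
  have hpos : ∀ᶠ z : ℝ × E in 𝓝[>] (0 : ℝ) ×ˢ 𝓝 k, 0 < z.1 :=
    tendsto_fst.eventually self_mem_nhdsWithin
  have hsmall : ∀ᶠ z : ℝ × E in 𝓝[>] (0 : ℝ) ×ˢ 𝓝 k, ‖z.1 • z.2‖ < r :=
    (tendsto_fst_smul_snd k).norm.eventually_lt_const (by simpa using H.pos)
  have hpiece : ∀ᶠ z : ℝ × E in 𝓝[>] (0 : ℝ) ×ˢ 𝓝 k, ∀ i, z.2 ∈ polyCone (T i) →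
      c * z.1 < z.1 * ⟪z.2, A i z.2⟫ + 2 * ⟪b i, z.2⟫ := by
    refine eventually_all.2 fun i => ?_
    by_cases hki : k ∈ polyCone (T i)
    · rcases (H.inner_nonneg hki).eq_or_lt with hb | hb
      · have hlim : Tendsto (fun z : ℝ × E => ⟪z.2, A i z.2⟫) (𝓝 (0, k)) (𝓝 ⟪k, A i k⟫) :=
          Continuous.tendsto (by fun_prop : Continuous fun z : ℝ × E => ⟪z.2, A i z.2⟫) (0, k)
        filter_upwards [(hlim.mono_left hle).eventually_const_lt
          (hc i (H.mem_faceConstraints.2 ⟨hki, hb.symm⟩)), hpos] with z hz hz0 hzi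
        have := H.inner_nonneg hzi
        nlinarith
      · have hlim : Tendsto (fun z : ℝ × E => z.1 * ⟪z.2, A i z.2⟫ + 2 * ⟪b i, z.2⟫ - c * z.1)
            (𝓝 (0, k)) (𝓝 (0 * ⟪k, A i k⟫ + 2 * ⟪b i, k⟫ - c * 0)) :=
          Continuous.tendsto (by fun_prop : Continuous fun z : ℝ × E =>
            z.1 * ⟪z.2, A i z.2⟫ + 2 * ⟪b i, z.2⟫ - c * z.1) (0, k)
        filter_upwards [(hlim.mono_left hle).eventually_const_lt (u := 0) (by linarith)]
          with z hz _
        linarith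
    · filter_upwards [tendsto_snd.eventually
        ((isClosed_polyCone (T i)).isOpen_compl.mem_nhds hki)] with z hz hzi
      exact absurd hzi hz
  refine le_liminf_of_le (by isBoundedDefault) ?_
  filter_upwards [hpos, hsmall, hpiece] with z hz hzr hzc
  by_cases hD : z.1 • z.2 ∈ shiftedDomain q x
  · rw [secondDiffQuotient_eq_coe hq hx hD, EReal.coe_le_coe_iff,
      le_inv_mul_iff₀ (by positivity)]
    obtain ⟨i, hi⟩ := (H.mem_iff _ hzr).1 hD
    have := hzc i ((smul_mem_polyCone_iff hz).1 hi)
    rw [H.eq i _ hzr hi, quadratic_smul, inner_smul_right]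
    have := mul_le_mul_of_nonneg_left this.le hz.le
    linarith
  · rw [secondDiffQuotient_eq_top hq hz hx hD]
    exact le_top

lemma IsLocallyPLQ.secondSubderivative_le (hq : ∀ x, q x ≠ ⊥) (hx : q x ≠ ⊤)
    (H : IsLocallyPLQ T A b (shiftedDomain q x) (tiltedIncrement q x v) r) {k : E} {i : ι}
    (hk : k ∈ polyCone (faceConstraints T b i)) :
    secondSubderivative q x v k ≤ (⟪k, A i k⟫ : ℝ) := by
  obtain ⟨t₀, ht₀, hsmall⟩ := exists_forall_norm_smul_lt k H.pos
  obtain ⟨hki, hb⟩ := H.mem_faceConstraints.1 hk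
  have hev : ∀ᶠ t : ℝ in 𝓝[>] 0, secondDiffQuotient q x v t k ≤ (⟪k, A i k⟫ : ℝ) := by
    filter_upwards [Ioc_mem_nhdsGT ht₀] with t ht
    have htr := hsmall t ht.1 ht.2
    have hmem := smul_mem_polyCone hki ht.1.le
    rw [secondDiffQuotient_eq_coe hq hx ((H.mem_iff _ htr).2 ⟨i, hmem⟩), EReal.coe_le_coe_iff,
      H.eq i _ htr hmem, quadratic_smul, inner_smul_right, hb,
      inv_mul_le_iff₀ (by have := ht.1; positivity)]
    linarith
  exact liminf_le_of_frequently_le'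
    ((tendsto_id.prodMk tendsto_const_nhds).frequently hev.frequently)

/-- Both sides equal `2 g(t k) / t²` for small `t > 0`, with `g` the tilted increment. -/
lemma IsLocallyPLQ.inner_eq_of_mem_faces
    (H : IsLocallyPLQ T A b (shiftedDomain q x) (tiltedIncrement q x v) r) {k : E} {i j : ι}
    (hi : k ∈ polyCone (faceConstraints T b i)) (hj : k ∈ polyCone (faceConstraints T b j)) :
    ⟪k, A i k⟫ = ⟪k, A j k⟫ := by
  obtain ⟨t₀, ht₀, hsmall⟩ := exists_forall_norm_smul_lt k H.pos
  have htr := hsmall t₀ ht₀ le_rfl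
  obtain ⟨hki, hbi⟩ := H.mem_faceConstraints.1 hi
  obtain ⟨hkj, hbj⟩ := H.mem_faceConstraints.1 hj
  have h1 := H.eq i _ htr (smul_mem_polyCone hki ht₀.le)
  rw [H.eq j _ htr (smul_mem_polyCone hkj ht₀.le), quadratic_smul, quadratic_smul,
    inner_smul_right, inner_smul_right, hbi, hbj, mul_zero, add_zero, add_zero] at h1
  have := mul_left_cancel₀ ht₀.ne' (mul_left_cancel₀ ht₀.ne' h1)
  linarith

lemma IsLocallyPLQ.halfSecondSubderivative_eq_coe [Finite ι] (hq : ∀ x, q x ≠ ⊥) (hx : q x ≠ ⊤)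
    (H : IsLocallyPLQ T A b (shiftedDomain q x) (tiltedIncrement q x v) r) {k : E} {i : ι}
    (hk : k ∈ polyCone (faceConstraints T b i)) :
    halfSecondSubderivative q x v k = ((1 / 2 * ⟪k, A i k⟫ : ℝ) : EReal) := by
  have : secondSubderivative q x v k = (⟪k, A i k⟫ : ℝ) := by
    refine le_antisymm (H.secondSubderivative_le hq hx hk) ?_
    rw [← EReal.ge_of_forall_gt_iff_ge]
    intro c hc
    refine H.le_secondSubderivative hq hx fun j hj => ?_
    rw [H.inner_eq_of_mem_faces hj hk]
    exact EReal.coe_lt_coe_iff.1 hc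
  rw [halfSecondSubderivative, this, EReal.coe_mul]

lemma IsLocallyPLQ.halfSecondSubderivative_eq_top [Finite ι] (hq : ∀ x, q x ≠ ⊥) (hx : q x ≠ ⊤)
    (H : IsLocallyPLQ T A b (shiftedDomain q x) (tiltedIncrement q x v) r) {k : E}
    (hk : ∀ i, k ∉ polyCone (faceConstraints T b i)) :
    halfSecondSubderivative q x v k = ⊤ := by
  have : secondSubderivative q x v k = ⊤ := by
    rw [← top_le_iff, ← EReal.ge_of_forall_gt_iff_ge]
    intro c _
    exact H.le_secondSubderivative hq hx fun i hi => absurd hi (hk i)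
  rw [halfSecondSubderivative, this]
  exact EReal.coe_mul_top_of_pos one_half_pos

/-- For a convex piecewise linear-quadratic function `q`, the function `½ d²q(x | v)` is piecewise
quadratic on polyhedral cones, and its subgradients near the origin are the increments of the
subgradients of `q` near `(x, v)`. -/
theorem exists_isConicPLQ_halfSecondSubderivative [FiniteDimensional ℝ E] (hq : ∀ x, q x ≠ ⊥)
    (hconvex : IsConvexFun q) (hplq : IsPiecewiseLinearQuadratic q)
    (hv : v ∈ subdifferential q x) :
    ∃ (ι : Type) (_ : Finite ι) (T : ι → Finset E) (A : ι → E →L[ℝ] E) (D : Set E) (f : E → ℝ),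
      IsConicPLQ T A D f ∧
      (∀ k, subdifferential (halfSecondSubderivative q x v) k = subgradients D f k) ∧
      ∃ ε : ℝ, 0 < ε ∧ ∀ k u : E, ‖k‖ < ε → ‖u‖ < ε →
        (v + u ∈ subdifferential q (x + k) ↔ u ∈ subgradients D f k) := by
  obtain ⟨ι, hι, T, A, b, r, H⟩ := exists_isLocallyPLQ hq hconvex hplq hv
  have hx : q x ≠ ⊤ := hv.2.1
  set φ := halfSecondSubderivative q x v with hφ
  have hdom : effDomain φ = ⋃ i, polyCone (faceConstraints T b i) := by
    ext k
    rw [Set.mem_iUnion]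
    constructor
    · intro hk
      by_contra! h
      exact ne_of_lt hk (H.halfSecondSubderivative_eq_top hq hx h)
    · rintro ⟨i, hi⟩
      change φ k < ⊤
      rw [hφ, H.halfSecondSubderivative_eq_coe hq hx hi]
      exact EReal.coe_lt_top _
  have hbot : ∀ k, φ k ≠ ⊥ := by
    intro k
    by_cases hk : ∃ i, k ∈ polyCone (faceConstraints T b i)
    · obtain ⟨i, hi⟩ := hk
      rw [hφ, H.halfSecondSubderivative_eq_coe hq hx hi]
      exact EReal.coe_ne_bot _
    · push Not at hk
      rw [hφ, H.halfSecondSubderivative_eq_top hq hx hk]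
      exact top_ne_bot
  have H' : IsConicPLQ (faceConstraints T b) A (effDomain φ) fun k => (φ k).toReal :=
    H.isConicPLQ hdom fun i k hk => by
      rw [hφ, H.halfSecondSubderivative_eq_coe hq hx hk, EReal.toReal_coe]
  obtain ⟨ε, hε, hiff⟩ := H.exists_mem_subgradients_iff H'
  refine ⟨ι, hι, _, A, _, _, H', fun k => Set.ext fun u => mem_subdifferential_iff hbot,
    ε, hε, fun k u hk hu => ?_⟩
  rw [add_mem_subdifferential_iff hq, hiff k u hk hu]

end SecondSubderivative

/-! ### Parametric contraction principle. -/

section Contraction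

variable {P E : Type*} [NormedAddCommGroup P] [NormedAddCommGroup E] [CompleteSpace E]

/-- Parametric contraction principle around a fixed point `0` of `R p₀`. -/
lemma exists_lipschitz_fixedPoint {R : P → E → E} {p₀ : P} {ρ : ℝ} (hρ : 0 < ρ) {K : NNReal}
    (hR₀ : R p₀ 0 = 0)
    (hk : ∀ p ∈ Metric.ball p₀ ρ, ∀ k ∈ Metric.closedBall (0 : E) ρ,
      ∀ k' ∈ Metric.closedBall (0 : E) ρ, ‖R p k - R p k'‖ ≤ 1 / 2 * ‖k - k'‖)
    (hp : ∀ p ∈ Metric.ball p₀ ρ, ∀ p' ∈ Metric.ball p₀ ρ, ∀ k ∈ Metric.closedBall (0 : E) ρ,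
      ‖R p k - R p' k‖ ≤ K * ‖p - p'‖) :
    ∃ δ : ℝ, 0 < δ ∧ δ ≤ ρ ∧ ∃ σ : P → E, LipschitzOnWith (2 * K) σ (Metric.ball p₀ δ) ∧
      σ p₀ = 0 ∧ ∀ p ∈ Metric.ball p₀ δ, ∀ k,
        (k ∈ Metric.closedBall (0 : E) ρ ∧ k = R p k) ↔ k = σ p := by
  have hp₀ : p₀ ∈ Metric.ball p₀ ρ := Metric.mem_ball_self hρ
  have h0 : (0 : E) ∈ Metric.closedBall (0 : E) ρ := Metric.mem_closedBall_self hρ.le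
  -- This gives `K * δ ≤ ρ / 2`, so `R p` maps the closed `ρ`-ball to itself: `‖R p k‖ ≤ ρ / 2 + K *
  -- δ`.
  set δ := min ρ (ρ / (2 * (K + 1))) with hδ
  have hδ0 : 0 < δ := lt_min hρ (by positivity)
  have hδρ : δ ≤ ρ := min_le_left _ _
  have hδK : K * δ ≤ ρ / 2 := by
    have : δ * (2 * (K + 1)) ≤ ρ := (le_div_iff₀ (by positivity)).1 (min_le_right _ _)
    linarith
  have huniq : ∀ p ∈ Metric.ball p₀ ρ, ∀ k ∈ Metric.closedBall (0 : E) ρ,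
      ∀ p' ∈ Metric.ball p₀ ρ, ∀ k' ∈ Metric.closedBall (0 : E) ρ, k = R p k → k' = R p' k' →
      ‖k - k'‖ ≤ 2 * K * ‖p - p'‖ := by
    intro p hpm k hkm p' hpm' k' hkm' h h'
    have h1 := hk p hpm k hkm k' hkm'
    have h2 := hp p hpm p' hpm' k' hkm'
    have h3 := norm_add_le (R p k - R p k') (R p k' - R p' k')
    rw [sub_add_sub_cancel, ← h, ← h'] at h3
    rw [← h] at h1
    rw [← h'] at h2
    linarith
  have hex : ∀ p ∈ Metric.ball p₀ δ, ∃ k ∈ Metric.closedBall (0 : E) ρ, k = R p k := by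
    intro p hpδ
    have hpρ := Metric.ball_subset_ball hδρ hpδ
    have hmaps : Set.MapsTo (R p) (Metric.closedBall 0 ρ) (Metric.closedBall 0 ρ) := by
      intro k hkm
      have h1 := hk p hpρ k hkm 0 h0
      have h2 := hp p hpρ p₀ hp₀ 0 h0
      rw [hR₀, sub_zero] at h2
      rw [sub_zero] at h1
      have h3 := norm_add_le (R p k - R p 0) (R p 0)
      rw [sub_add_cancel] at h3
      have hpn : ‖p - p₀‖ < δ := by rwa [← dist_eq_norm]
      have h4 := mul_le_mul_of_nonneg_left hpn.le K.2
      rw [mem_closedBall_zero_iff] at hkm ⊢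
      change (K : ℝ) * _ ≤ (K : ℝ) * _ at h4
      linarith
    have hcontr : ContractingWith (1 / 2) (hmaps.restrict (R p) _ _) := by
      refine ⟨by rw [← NNReal.coe_lt_coe]; norm_num, LipschitzWith.of_dist_le_mul fun k k' => ?_⟩
      have := hk p hpρ k k.2 k' k'.2
      simpa [Subtype.dist_eq, dist_eq_norm] using this
    obtain ⟨k, hkm, hfix, -⟩ := hcontr.exists_fixedPoint' Metric.isClosed_closedBall.isComplete
      hmaps h0 (edist_ne_top _ _)
    exact ⟨k, hkm, hfix.symm⟩
  choose! σ hσ hσfix using hex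
  have hiff : ∀ p ∈ Metric.ball p₀ δ, ∀ k,
      (k ∈ Metric.closedBall (0 : E) ρ ∧ k = R p k) ↔ k = σ p := by
    intro p hpδ k
    have hpρ := Metric.ball_subset_ball hδρ hpδ
    constructor
    · rintro ⟨h1, h2⟩
      have := huniq p hpρ k h1 p hpρ (σ p) (hσ p hpδ) h2 (hσfix p hpδ)
      rw [sub_self, norm_zero, mul_zero] at this
      exact sub_eq_zero.1 (norm_le_zero_iff.1 this)
    · rintro rfl
      exact ⟨hσ p hpδ, hσfix p hpδ⟩
  refine ⟨δ, hδ0, hδρ, σ, LipschitzOnWith.of_dist_le_mul fun p hpδ p' hpδ' => ?_,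
    ((hiff p₀ (Metric.mem_ball_self hδ0) 0).1 ⟨h0, hR₀.symm⟩).symm, hiff⟩
  rw [dist_eq_norm, dist_eq_norm]
  exact huniq p (Metric.ball_subset_ball hδρ hpδ) _ (hσ p hpδ) p'
    (Metric.ball_subset_ball hδρ hpδ') _ (hσ p' hpδ') (hσfix p hpδ) (hσfix p' hpδ')

end Contraction

/-! ### Linearization of `F` and the localization of the solution map. -/

section Localization

variable {P E : Type*} [NormedAddCommGroup P] [NormedSpace ℝ P] [NormedAddCommGroup E]
  [InnerProductSpace ℝ E]

/-- Lipschitz estimates for `ξ` applied to the linearization error of `F` in its second variable. -/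
lemma exists_linearization_estimates {F : P × E → E} {p₀ : P} {x₀ : E} {F' : P × E →L[ℝ] E}
    (hF : HasStrictFDerivAt F F' (p₀, x₀)) {ξ : E → E} {L : NNReal} (hξ : LipschitzWith L ξ) :
    ∃ K : NNReal, ∃ ρ₀ : ℝ, 0 < ρ₀ ∧ ∀ ρ : ℝ, ρ < ρ₀ →
      (∀ p ∈ Metric.ball p₀ ρ, ∀ k ∈ Metric.closedBall (0 : E) ρ,
        ∀ k' ∈ Metric.closedBall (0 : E) ρ,
        ‖ξ (F' (0, k) - F (p, x₀ + k) + F (p₀, x₀)) -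
          ξ (F' (0, k') - F (p, x₀ + k') + F (p₀, x₀))‖ ≤ 1 / 2 * ‖k - k'‖) ∧
      ∀ p ∈ Metric.ball p₀ ρ, ∀ p' ∈ Metric.ball p₀ ρ, ∀ k ∈ Metric.closedBall (0 : E) ρ,
        ‖ξ (F' (0, k) - F (p, x₀ + k) + F (p₀, x₀)) -
          ξ (F' (0, k) - F (p', x₀ + k) + F (p₀, x₀))‖ ≤ K * ‖p - p'‖ := by
  -- Error constant in strict differentiability, chosen so that `L * c ≤ 1/2`; the `+ 1` covers `L =
  -- 0`.
  set c : NNReal := 1 / (2 * (L + 1)) with hc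
  have hc0 : 0 < c := by positivity
  have hLc : L * (c : ℝ) ≤ 1 / 2 := by
    rw [hc]
    push_cast
    rw [mul_one_div, div_le_iff₀ (by positivity)]
    linarith
  obtain ⟨s, hs, happrox⟩ := hF.approximates_deriv_on_nhds (Or.inr hc0)
  obtain ⟨ρ₀, hρ₀, hball⟩ := Metric.mem_nhds_iff.1 hs
  refine ⟨L * (‖F'‖₊ + c), ρ₀, hρ₀, fun ρ hρ => ?_⟩
  have hmem : ∀ p ∈ Metric.ball p₀ ρ, ∀ k ∈ Metric.closedBall (0 : E) ρ, (p, x₀ + k) ∈ s := by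
    intro p hp k hk
    apply hball
    rw [mem_closedBall_zero_iff] at hk
    rw [Metric.mem_ball, Prod.dist_eq, max_lt_iff]
    exact ⟨lt_trans hp hρ, by simpa using hk.trans_lt hρ⟩
  have hL : ∀ v w, ‖ξ v - ξ w‖ ≤ L * ‖v - w‖ := fun v w => by
    simpa [dist_eq_norm] using hξ.dist_le_mul v w
  constructor
  · intro p hp k hk k' hk'
    refine (hL _ _).trans ?_
    have h1 := happrox _ (hmem p hp k hk) _ (hmem p hp k' hk')
    have h2 : ((p, x₀ + k) : P × E) - (p, x₀ + k') = (0, k - k') := by simp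
    have h3 : F' (0, k - k') = F' (0, k) - F' (0, k') := by rw [← map_sub]; simp
    have h4 : ‖((0, k - k') : P × E)‖ = ‖k - k'‖ := by simp [Prod.norm_def]
    rw [h2, h3, h4, ← norm_neg] at h1
    have h5 : F' (0, k) - F (p, x₀ + k) + F (p₀, x₀) - (F' (0, k') - F (p, x₀ + k') + F (p₀, x₀)) =
        -(F (p, x₀ + k) - F (p, x₀ + k') - (F' (0, k) - F' (0, k'))) := by abel
    rw [h5]
    calc (L : ℝ) * _ ≤ L * (c * ‖k - k'‖) := by gcongr
      _ = (L * c) * ‖k - k'‖ := by ring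
      _ ≤ _ := by gcongr
  · intro p hp p' hp' k hk
    refine (hL _ _).trans ?_
    have h1 := happrox _ (hmem p hp k hk) _ (hmem p' hp' k hk)
    have h2 : ((p, x₀ + k) : P × E) - (p', x₀ + k) = (p - p', 0) := by simp
    have h4 : ‖((p - p', 0) : P × E)‖ = ‖p - p'‖ := by simp [Prod.norm_def]
    have h6 := F'.le_opNorm (p - p', 0)
    rw [h2, h4] at h1
    rw [h4] at h6
    have h5 : F' (0, k) - F (p, x₀ + k) + F (p₀, x₀) - (F' (0, k) - F (p', x₀ + k) + F (p₀, x₀)) =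
        -(F (p, x₀ + k) - F (p', x₀ + k)) := by abel
    have h7 := norm_add_le (F (p, x₀ + k) - F (p', x₀ + k) - F' (p - p', 0)) (F' (p - p', 0))
    rw [sub_add_cancel] at h7
    rw [h5, norm_neg]
    calc (L : ℝ) * _ ≤ L * (c * ‖p - p'‖ + ‖F'‖ * ‖p - p'‖) := by gcongr; linarith
      _ = _ := by push_cast; ring

/-- If `Ξ` is single-valued, then the solution mapping has a single-valued Lipschitzian
localization. -/
theorem hasSingleValuedLipschitzLocalization_solutionMap [FiniteDimensional ℝ E] {F : P × E → E} {q : E → EReal}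
    {p₀ : P} {x₀ : E} (hF : HasStrictFDerivAt F (fderiv ℝ F (p₀, x₀)) (p₀, x₀))
    (hq : ∀ x, q x ≠ ⊥) (hconvex : IsConvexFun q) (hplq : IsPiecewiseLinearQuadratic q)
    (hx₀ : x₀ ∈ solutionMap F q p₀) (hXi : ∀ w : E, ∃! k, k ∈ XiMap F q p₀ x₀ w) :
    HasSingleValuedLipschitzLocalization (solutionMap F q) p₀ x₀ := by
  set F' := fderiv ℝ F (p₀, x₀) with hF'
  have hM : ∀ k, partialDerivX F p₀ x₀ k = F' (0, k) := by
    intro k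
    have h1 : HasFDerivAt (fun y => F (p₀, y)) (F' ∘L ContinuousLinearMap.inr ℝ P E) x₀ :=
      hF.hasFDerivAt.comp x₀ (hasFDerivAt_prodMk_right p₀ x₀)
    rw [partialDerivX, h1.fderiv]
    rfl
  have hsol : ∀ p x, x ∈ solutionMap F q p ↔ -F (p, x) ∈ subdifferential q x := by
    intro p x
    constructor
    · rintro ⟨v, hv, h⟩
      rwa [neg_eq_of_add_eq_zero_right h.symm]
    · exact fun h => ⟨_, h, (add_neg_cancel _).symm⟩
  have hv₀ := (hsol p₀ x₀).1 hx₀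
  obtain ⟨ι, _, T, A, D, f, H, hsub, ε, hε, hlocal⟩ :=
    exists_isConicPLQ_halfSecondSubderivative hq hconvex hplq hv₀
  choose ξ hξ hξuniq using hXi
  have hξiff : ∀ w k, w - partialDerivX F p₀ x₀ k ∈ subgradients D f k ↔ k = ξ w := by
    intro w k
    rw [← hsub]
    constructor
    · exact fun h => hξuniq w k ⟨_, h, (add_sub_cancel _ _).symm⟩
    · rintro rfl
      obtain ⟨v, hv, h⟩ := hξ w
      rwa [← eq_sub_of_add_eq' h.symm]
  obtain ⟨L, hL⟩ := H.exists_lipschitzWith_inverse _ hξiff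
  let R : P → E → E := fun p k => ξ (F' (0, k) - F (p, x₀ + k) + F (p₀, x₀))
  -- With `u = F(p₀, x₀) - F(p, x₀ + k)`, `-F(p, x₀ + k) = v + u`; the local reduction turns the
  -- inclusion into `u ∈ ∂φ(k)`, that is, `k = ξ(M k + u)`.
  have hfix : ∀ p k, ‖k‖ < ε → ‖F (p₀, x₀) - F (p, x₀ + k)‖ < ε →
      (x₀ + k ∈ solutionMap F q p ↔ k = R p k) := by
    intro p k hk hu
    have h := hlocal k _ hk hu
    rw [← hξiff, hM, hsol]
    convert h using 2 <;> abel
  obtain ⟨K, ρ₀, hρ₀, hest⟩ := exists_linearization_estimates hF hL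
  have hcont : ∀ᶠ z : P × E in 𝓝 (p₀, x₀), ‖F (p₀, x₀) - F z‖ < ε := by
    have := (hF.continuousAt.tendsto.const_sub (F (p₀, x₀))).norm
    rw [sub_self, norm_zero] at this
    exact this.eventually_lt_const hε
  obtain ⟨ρ₁, hρ₁, hball⟩ := Metric.eventually_nhds_iff_ball.1 hcont
  set ρ := min (min ρ₀ ρ₁) ε / 2 with hρdef
  have hmin : 0 < min (min ρ₀ ρ₁) ε := lt_min (lt_min hρ₀ hρ₁) hε
  have hρ : 0 < ρ := half_pos hmin
  have hρlt : ρ < min (min ρ₀ ρ₁) ε := half_lt_self hmin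
  have hρ₀' : ρ < ρ₀ := hρlt.trans_le ((min_le_left _ _).trans (min_le_left _ _))
  have hρ₁' : ρ < ρ₁ := hρlt.trans_le ((min_le_left _ _).trans (min_le_right _ _))
  have hρε : ρ < ε := hρlt.trans_le (min_le_right _ _)
  have hfix' : ∀ p ∈ Metric.ball p₀ ρ, ∀ k ∈ Metric.closedBall (0 : E) ρ,
      (x₀ + k ∈ solutionMap F q p ↔ k = R p k) := by
    intro p hp k hk
    rw [mem_closedBall_zero_iff] at hk
    refine hfix p k (hk.trans_lt hρε) (hball _ ?_)
    rw [Metric.mem_ball, Prod.dist_eq, max_lt_iff]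
    exact ⟨lt_trans hp hρ₁', by simpa using hk.trans_lt hρ₁'⟩
  have hR₀ : R p₀ 0 = 0 := by
    have := (hfix' p₀ (Metric.mem_ball_self hρ) 0 (Metric.mem_closedBall_self hρ.le)).1
      (by rwa [add_zero])
    exact this.symm
  obtain ⟨hest₁, hest₂⟩ := hest ρ hρ₀'
  obtain ⟨δ, hδ, hδρ, σ, hσlip, hσ₀, hσ⟩ :=
    exists_lipschitz_fixedPoint (R := R) hρ hR₀ hest₁ hest₂
  refine ⟨Metric.ball p₀ δ, Metric.ball_mem_nhds _ hδ, Metric.closedBall x₀ ρ,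
    Metric.closedBall_mem_nhds _ hρ, fun p => x₀ + σ p, ⟨2 * K, ?_⟩, by simp [hσ₀], ?_⟩
  · intro p hp p' hp'
    rw [edist_add_left]
    exact hσlip hp hp'
  · intro p hp
    ext x
    have hx : x₀ + (x - x₀) = x := add_sub_cancel _ _
    have h1 : x ∈ Metric.closedBall x₀ ρ ↔ x - x₀ ∈ Metric.closedBall (0 : E) ρ := by
      rw [mem_closedBall_zero_iff, Metric.mem_closedBall, dist_eq_norm]
    rw [Set.mem_inter_iff, h1, Set.mem_singleton_iff, ← sub_eq_iff_eq_add', ← hσ p hp, and_comm]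
    refine and_congr_right fun hk => ?_
    rw [← hfix' p (Metric.ball_subset_ball hδρ hp) _ hk, hx]

end Localization

end VarIneq

theorem proposition2 (m s : ℕ)
    (F : EuclideanSpace ℝ (Fin m) × EuclideanSpace ℝ (Fin s) → EuclideanSpace ℝ (Fin s))
    (hF : ContDiff ℝ 1 F)
    (q : EuclideanSpace ℝ (Fin s) → EReal)
    (hproper : VarIneq.IsProper q)
    (hconvex : VarIneq.IsConvexFun q)
    (hlsc : LowerSemicontinuous q)
    (hplq : VarIneq.IsPiecewiseLinearQuadratic q)
    (p₀ : EuclideanSpace ℝ (Fin m)) (x₀ : EuclideanSpace ℝ (Fin s))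
    (hx₀ : x₀ ∈ VarIneq.solutionMap F q p₀)
    (hXi : ∀ w : EuclideanSpace ℝ (Fin s), ∃! k, k ∈ VarIneq.XiMap F q p₀ x₀ w) :
    VarIneq.HasSingleValuedLipschitzLocalization (VarIneq.solutionMap F q) p₀ x₀ := by
  exact VarIneq.hasSingleValuedLipschitzLocalization_solutionMap
    (hF.contDiffAt.hasStrictFDerivAt one_ne_zero) hproper.1 hconvex hplq hx₀ hXi
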